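/- A weighted directed hypergraph $H=(V,F,z)$ consists of a finite set $V$ of $n$ vertices, a set $F$ of $m$ hyperarcs, each hyperarc $f$ being a pair $(t(f),h(f))$ of non-empty (not necessarily disjoint) subsets of $V$, and weights $z_f\ge 0$. Put $C(f)=t(f)\times h(f)$ and $$Q_H(x)=\sum_{f\in F} z_f\max_{(u,v)\in C(f)}\bigl(\max\{x_u-x_v,0\}\bigr)^2\qquad(x\in\mathbb R^V),$$ and let $r=\max_{f\in F}(|h(f)|+|t(f)|)$ be the rank of $H$. For $\varepsilon\in(0,1)$, an $\varepsilon$-spectral sparsifier of $H$ is a weighted directed hypergraph $\tilde H=(V,\tilde F,\tilde z)$ with $\tilde F\subseteq F$ and $(1-\varepsilon)Q_H(x)\le Q_{\tilde H}(x)\le(1+\varepsilon)Q_H(x)$ for all $x\in\mathbb R^V$. The algorithm DH-Sparsify, with constants $C_1,C_2$, works as follows. Let $m^*=\frac{n^2}{\varepsilon^2}\log^3\frac n\varepsilon$ and $T=\lceil\log_{4/3}(m/m^*)\rceil$. Start with $\tilde H_0=H$ and $i=0$. While $i<T$ and the number $m_i$ of hyperarcs of $\tilde H_i$ is at least $C_2m^*$,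 put $\varepsilon_i=\varepsilon/(4\log_{4/3}^2(m_i/m^*))$ and $\lambda_i=\lceil C_1\log^3 m_i/\varepsilon_i^2\rceil$, and obtain $\tilde H_{i+1}$ from $\tilde H_i$ in this way: starting with $S=\emptyset$, go through the pairs $(u,v)\in\bigcup_f C(f)$ one after the other and add to $S$ the $\lambda_i$ heaviest hyperarcs $f\notin S$ of $\tilde H_i$ with $(u,v)\in C(f)$ (all of them if there are fewer than $\lambda_i$); keep the hyperarcs in $S$ with their weights; keep each other hyperarc independently with probability $1/2$, doubling its weight if it is kept. Then increase $i$ by one. Return the last hypergraph $\tilde H=(V,\tilde F,\tilde z)$. The heaviest hyperarcs are found by the deterministic linear-time selection algorithm (median of medians). Running time is counted, up to a constant factor, as the number of unit-cost operations (on vertices, hyperarc names, integers and reals, table entries and list cells, and fair coin flips) of a random access machine. **Theorem.** If the constant $C_1$ is sufficiently large, and the constant $C_2$ is sufficiently large depending on $C_1$, then there is a constant $K$, depending only on $C_1$ and $C_2$, such that for every weighted directed hypergraph $H=(V,F,z)$ with $n$ vertices and every $\varepsilon\in(0,1)$: 1. with probability at least $1-\frac Kn$, the output $\tilde H=(V,\tilde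 F,\tilde z)$ of DH-Sparsify is an $\varepsilon$-spectral sparsifier of $H$ and $|\tilde F|\le K\,\frac{n^2}{\varepsilon^2}\log^3\frac n\varepsilon$; 2. if $m\ge1$, then with probability at least $1-\frac Kn$ the running time of DH-Sparsify is at most $K\,mr^2$. -/

import Mathlib

open scoped NNReal

noncomputable section

/-! ## Directed hypergraphs, their energy, and spectral sparsifiers -/

/-- A hyperarc on `V`: a pair (tail, head) of non-empty, not necessarily disjoint, subsets. -/
abbrev Hyperarc (V : Type) : Type :=
  {f : Finset V × Finset V // f.1.Nonempty ∧ f.2.Nonempty}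

namespace Hyperarc

variable {V : Type}

/-- The tail `t(f)`. -/
def tail (f : Hyperarc V) : Finset V := f.1.1

/-- The head `h(f)`. -/
def head (f : Hyperarc V) : Finset V := f.1.2

/-- The biclique `C(f) = t(f) × h(f)`. -/
def biclique (f : Hyperarc V) : Finset (V × V) := f.tail ×ˢ f.head

theorem biclique_nonempty (f : Hyperarc V) : f.biclique.Nonempty :=
  Finset.Nonempty.product f.2.1 f.2.2

end Hyperarc

/-- A weighted directed hypergraph `(V, F, z)` with `F = arcs` and `z = weight ≥ 0`.
Only the values of `weight` on `arcs` are ever used. -/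
structure DirHypergraph (V : Type) where
  arcs : Finset (Hyperarc V)
  weight : Hyperarc V → ℝ≥0

namespace DirHypergraph

variable {V : Type}

/-- The energy of the hyperarc `f`: `z_f * max_{u ∈ t(f), v ∈ h(f)} (x_u - x_v)_+ ^ 2`. -/
def arcEnergy (H : DirHypergraph V) (x : V → ℝ) (f : Hyperarc V) : ℝ :=
  (H.weight f : ℝ) *
    f.biclique.sup' f.biclique_nonempty (fun p => (max (x p.1 - x p.2) 0) ^ 2)

/-- The quadratic form `xᵀ L_H(x)`. -/
def energy (H : DirHypergraph V) (x : V → ℝ) : ℝ :=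
  ∑ f ∈ H.arcs, H.arcEnergy x f

/-- The rank: the maximum of `|h(f)| + |t(f)|` over the hyperarcs `f`. -/
def rank (H : DirHypergraph V) : ℕ :=
  H.arcs.sup (fun f => f.head.card + f.tail.card)

/-- `G` is an `ε`-spectral sparsifier of `H`. -/
def IsSpectralSparsifier (ε : ℝ) (H G : DirHypergraph V) : Prop :=
  G.arcs ⊆ H.arcs ∧
    ∀ x : V → ℝ, (1 - ε) * H.energy x ≤ G.energy x ∧ G.energy x ≤ (1 + ε) * H.energy x

end DirHypergraph

/-! ## Computations with a step count

The programs below run on a random access machine with unit-cost operations on vertices,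
hyperarc names, integers and reals (arithmetic, comparison, logarithm, rounding), unit-cost
access to table entries and to the first cell of a linked list, and fair coin flips.  Tables
are initialised lazily.  Every clause of every recursive function below starts with a `tick`
and performs, apart from its calls of other functions (which are charged on their own), at most
a fixed number of such unit-cost operations; so the step count is the running time up to an
absolute constant factor. -/

/-- The result of a deterministic computation together with the number of its steps. -/
structure Timed (α : Type) where
  val : α
  time : ℕ

instance : Monad Timed where
  pure a := ⟨a, 0⟩
  bind x f := ⟨(f x.val).val, x.time + (f x.val).time⟩

/-- One step. -/
def Timed.tick : Timed Unit := ⟨(), 1⟩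

/-- A randomised computation: the joint law of its result and of the number of its steps. -/
def Comp (α : Type) : Type := PMF (α × ℕ)

instance : Monad Comp where
  pure a := PMF.pure (a, 0)
  bind x f := PMF.bind x fun p => PMF.map (fun q => (q.1, p.2 + q.2)) (f p.1)

/-- Run a deterministic computation inside a randomised one. -/
def Comp.lift {α : Type} (x : Timed α) : Comp α := PMF.pure (x.val, x.time)

/-- A fair coin flip, which takes one step. -/
def Comp.coin : Comp Bool := PMF.map (fun b => (b, 1)) (PMF.uniformOfFintype Bool)

/-- The probability that the pair (result, number of steps) lies in `E`. -/
def Comp.prob {α : Type} (X : Comp α) (E : Set (α × ℕ)) : ℝ :=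
  (PMF.toOuterMeasure X E).toReal

/-! ## Elementary list programs -/

section Lists

variable {α : Type}

/-- The length of a list. -/
def lengthT : List α → Timed ℕ
  | [] => do
    Timed.tick
    return 0
  | _ :: l => do
    Timed.tick
    let k ← lengthT l
    return k + 1

/-- Concatenation of two lists. -/
def appendT : List α → List α → Timed (List α)
  | [], l' => do
    Timed.tick
    return l'
  | a :: l, l' => do
    Timed.tick
    let r ← appendT l l'
    return a :: r

/-- The first `k` entries of a list. -/
def takeT : ℕ → List α → Timed (List α)
  | 0, _ => do
    Timed.tick
    return []
  | _ + 1, [] => do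
    Timed.tick
    return []
  | k + 1, a :: l => do
    Timed.tick
    let r ← takeT k l
    return a :: r

/-- The unmarked entries of a list. -/
def unmarkedT (mark : α → Bool) : List α → Timed (List α)
  | [] => do
    Timed.tick
    return []
  | a :: l => do
    Timed.tick
    let r ← unmarkedT mark l
    return if mark a then r else a :: r

/-- Mark all entries of a list. -/
def markT [DecidableEq α] : List α → (α → Bool) → Timed (α → Bool)
  | [], mark => do
    Timed.tick
    return mark
  | a :: l, mark => do
    Timed.tick
    markT l (Function.update mark a true)

end Lists

/-! ## Linear-time selection of the `k` heaviest entries of a list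

The pivot is the median of the medians of groups of five. -/

section Selection

variable {α β : Type} [LinearOrder β] (key : α → β)

/-- A list of bounded length, sorted by decreasing key. -/
def sortDesc (l : List α) : List α := l.insertionSort (fun a b => key b ≤ key a)

/-- The medians of the consecutive groups of five entries (an incomplete last group is left
out). -/
def mediansT : List α → Timed (List α)
  | a :: b :: c :: d :: e :: l => do
    Timed.tick
    let r ← mediansT l
    return (sortDesc key [a, b, c, d, e]).getD 2 c :: r
  | _ => do
    Timed.tick
    return []

/-- The minimum of `p` and the keys of the entries of the list. -/
def minKeyT : β → List α → Timed β
  | p, [] => do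
    Timed.tick
    return p
  | p, a :: l => do
    Timed.tick
    minKeyT (min p (key a)) l

/-- The entries with key above, equal to, and below `p`. -/
def partitionT (p : β) : List α → Timed (List α × List α × List α)
  | [] => do
    Timed.tick
    return ([], [], [])
  | a :: l => do
    Timed.tick
    let (gt, eq, lt) ← partitionT p l
    if p < key a then return (a :: gt, eq, lt)
    else if key a = p then return (gt, a :: eq, lt)
    else return (gt, eq, a :: lt)

/-- The `k` entries of `l` with the largest keys.  The first argument bounds the depth of the
recursion; the length of `l` is enough. -/
def heaviestT : ℕ → ℕ → List α → Timed (List α)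
  | 0, _, _ => do
    Timed.tick
    return []
  | fuel + 1, k, l => do
    Timed.tick
    let len ← lengthT l
    if len < 25 then return (sortDesc key l).take k
    else
      let meds ← mediansT key l
      let q ← lengthT meds
      let top ← heaviestT fuel ((q + 1) / 2) meds
      match top with
      | [] => return []
      | a :: top' =>
        let p ← minKeyT key (key a) top'
        let (gt, eq, lt) ← partitionT key p l
        let g ← lengthT gt
        let e ← lengthT eq
        if k ≤ g then heaviestT fuel k gt
        else if k ≤ g + e then
          let r ← takeT (k - g) eq
          appendT gt r
        else
          let r ← heaviestT fuel (k - g - e) lt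
          let s ← appendT eq r
          appendT gt s

end Selection

/-! ## The sparsification algorithm -/

section Algorithm

variable {V : Type} [LinearOrder V]

/-- The lists `A^{uv}` of the hyperarcs `f` with `(u, v) ∈ C(f)`, as a table `entry` indexed by
pairs of vertices, and the list `pairs` of the pairs whose entry is non-empty. -/
structure PairTable (V : Type) where
  pairs : List (V × V)
  entry : V × V → List (Hyperarc V)

/-- Put `f` into the list of the pair `p`. -/
def PairTable.push (A : PairTable V) (p : V × V) (f : Hyperarc V) : PairTable V where
  pairs := if (A.entry p).isEmpty then p :: A.pairs else A.pairs
  entry := Function.update A.entry p (f :: A.entry p)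

/-- Put `f` into the lists of the pairs `(u, v)`, for `v` in a list of vertices. -/
def insertHeadsT (f : Hyperarc V) (u : V) : List V → PairTable V → Timed (PairTable V)
  | [], A => do
    Timed.tick
    return A
  | v :: vs, A => do
    Timed.tick
    insertHeadsT f u vs (A.push (u, v) f)

/-- Put `f` into the lists of the pairs `(u, v)`, for `u` in a list of vertices and `v ∈ h(f)`.
(The input stores tails and heads as increasing lists of vertices.) -/
def insertTailsT (f : Hyperarc V) : List V → PairTable V → Timed (PairTable V)
  | [], A => do
    Timed.tick
    return A
  | u :: us, A => do
    Timed.tick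
    let A' ← insertHeadsT f u (f.head.sort (· ≤ ·)) A
    insertTailsT f us A'

/-- Put each hyperarc `f` of a list into the lists of all the pairs in `C(f)`. -/
def buildTableT : List (Hyperarc V) → PairTable V → Timed (PairTable V)
  | [], A => do
    Timed.tick
    return A
  | f :: l, A => do
    Timed.tick
    let A' ← insertTailsT f (f.tail.sort (· ≤ ·)) A
    buildTableT l A'

/-- The loop of CoresetFinder: for each pair `(u, v)` of a list, select the `lam` heaviest
hyperarcs of `A^{uv} \ S` (all of them if there are fewer than `lam`) and add them to the set
`S`, which is stored as a table of marks. -/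
def coresetLoopT (z : Hyperarc V → ℝ≥0) (lam : ℕ) (A : PairTable V) :
    List (V × V) → (Hyperarc V → Bool) → Timed (Hyperarc V → Bool)
  | [], S => do
    Timed.tick
    return S
  | p :: ps, S => do
    Timed.tick
    let B ← unmarkedT S (A.entry p)
    let len ← lengthT B
    if lam ≤ len then
      let Sp ← heaviestT z len lam B
      let S' ← markT Sp S
      coresetLoopT z lam A ps S'
    else
      let S' ← markT B S
      coresetLoopT z lam A ps S'

/-- CoresetFinder, for the hypergraph whose hyperarcs are the entries of `L`, with weights `z`.
The result is the indicator of the coreset `S`. -/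
def coresetFinder (L : List (Hyperarc V)) (z : Hyperarc V → ℝ≥0) (lam : ℕ) :
    Timed (Hyperarc V → Bool) := do
  Timed.tick
  let A ← buildTableT L ⟨[], fun _ => []⟩
  coresetLoopT z lam A A.pairs (fun _ => false)

/-- Keep the hyperarcs in `S`; keep any other hyperarc with probability `1/2`, independently,
and then double its weight. -/
def sampleArcs (S : Hyperarc V → Bool) :
    List (Hyperarc V) → (Hyperarc V → ℝ≥0) → Comp (List (Hyperarc V) × (Hyperarc V → ℝ≥0))
  | [], z => do
    Comp.lift Timed.tick
    return ([], z)
  | f :: l, z => do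
    Comp.lift Timed.tick
    if S f then
      let (l', z') ← sampleArcs S l z
      return (f :: l', z')
    else
      let b ← Comp.coin
      if b then
        let (l', z') ← sampleArcs S l (Function.update z f (2 * z f))
        return (f :: l', z')
      else sampleArcs S l z

/-- DH-Onestep. -/
def dhOnestep (L : List (Hyperarc V)) (z : Hyperarc V → ℝ≥0) (lam : ℕ) :
    Comp (List (Hyperarc V) × (Hyperarc V → ℝ≥0)) := do
  Comp.lift Timed.tick
  let S ← Comp.lift (coresetFinder L z lam)
  sampleArcs S L z

/-- The while loop of DH-Sparsify, with at most the given number of iterations. -/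
def dhLoop (C₁ C₂ ε mstar : ℝ) :
    ℕ → List (Hyperarc V) → (Hyperarc V → ℝ≥0) →
      Comp (List (Hyperarc V) × (Hyperarc V → ℝ≥0))
  | 0, L, z => do
    Comp.lift Timed.tick
    return (L, z)
  | t + 1, L, z => do
    Comp.lift Timed.tick
    let mi ← Comp.lift (lengthT L)
    if C₂ * mstar ≤ (mi : ℝ) then
      let εi : ℝ := ε / (4 * Real.logb (4 / 3) ((mi : ℝ) / mstar) ^ 2)
      let lam : ℕ := ⌈C₁ * Real.log (mi : ℝ) ^ 3 / εi ^ 2⌉₊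
      let (L', z') ← dhOnestep L z lam
      dhLoop C₁ C₂ ε mstar t L' z'
    else return (L, z)

/-- The target size `m* = (n² / ε²) log³ (n / ε)`. -/
def targetSize (n : ℕ) (ε : ℝ) : ℝ := (n : ℝ) ^ 2 / ε ^ 2 * Real.log ((n : ℝ) / ε) ^ 3

/-- DH-Sparsify, with constants `C₁` and `C₂`, for the hypergraph on `n` vertices whose
hyperarcs are the entries of `L`, with weights `z`. -/
def dhSparsify (C₁ C₂ : ℝ) (n : ℕ) (ε : ℝ) (L : List (Hyperarc V)) (z : Hyperarc V → ℝ≥0) :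
    Comp (List (Hyperarc V) × (Hyperarc V → ℝ≥0)) := do
  Comp.lift Timed.tick
  let m ← Comp.lift (lengthT L)
  let mstar : ℝ := targetSize n ε
  let T : ℕ := ⌈Real.logb (4 / 3) ((m : ℝ) / mstar)⌉₊
  dhLoop C₁ C₂ ε mstar T L z

/-- The hypergraph described by a list of hyperarcs and a table of weights. -/
def toHypergraph (R : List (Hyperarc V) × (Hyperarc V → ℝ≥0)) : DirHypergraph V where
  arcs := R.1.toFinset
  weight := R.2

end Algorithm

end

/-! One round either doubles or deletes the energy `q_f(x)` of each hyperarc outside the coreset, so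
the energy changes by a sum `∑ σ_f q_f(x)` with independent fair signs. This must be small compared
with `Q(x)` for all `x` at once. Let `w_p` be the largest weight of a hyperarc outside the coreset
whose biclique contains `p`, and put `b_p = w_p (x_u - x_v)_+²` for `p = (u, v)`. Then `q_f(x) =
max_p a_fp b_p`, where `a_fp = z_f / w_p ≤ 1` on `C(f)`, and `0` elsewhere, does not depend on `x`.
If `w_p` matters, the coreset contains `λ` hyperarcs reserved for `p` of weight at least `w_p`;
hence `λ ∑ b_p ≤ Q(x)` (`IsCoreset.sum_pairEnergy_le`), and `x` enters only through a vector in a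
small `ℓ¹` ball.

Chaining handles this ball (`abs_sum_weightedMax_le`). In units of `u = ε Q / (4m)`, round `b` down
to an integer vector `c` of `ℓ¹` norm at most `D = 4m / (ε λ)`, and cut the maximum at the heights
`D / 2^k`. The layer between `D / 2^(k+1)` and `D / 2^k` sees only the at most `2^(k+1)` coordinates
of `c` above its lower height, so level `k` involves at most `m^(4 · 2^(k+1))` functions. The
squares of the values of such a layer add up to at most `D / 2^(k+1) · 4m/ε`, and Hoeffding's bound
beats the union bound at every level as soon as `λ` is a large multiple of `log³ m / ε²`: two
logarithms pay for sharing the error among `O(log m)` levels, the third for the union bound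
(`sampleArcs_not_isGoodStep_le`).

A good round also leaves at most three quarters of the hyperarcs. So `ℓ = log_{4/3}(m_i / m*)` drops
by at least one per round, and the errors `ε / (4ℓ²)` telescope to at most `ε/4`
(`errorBudget_step`). A round fails with probability `O(1/m_i)`, which is `O(1/n²)`, and there are
`O(n)` rounds because `m ≤ 4^n`. A round always takes `O(m_i r²)` steps, as the lists of all pairs
have total length `∑ |C(f)|` and selection is linear (`heaviestT_spec`, `coresetFinder_time_le`);
when all rounds are good these costs form a geometric series (`dhLoop_not_isGoodRun_le`). -/

open scoped NNReal ENNReal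

noncomputable section

/-! ### Values and step counts of the elementary programs -/

namespace Timed

variable {α β : Type}

@[simp] theorem bind_val (x : Timed α) (f : α → Timed β) : (x >>= f).val = (f x.val).val := rfl

@[simp] theorem bind_time (x : Timed α) (f : α → Timed β) :
    (x >>= f).time = x.time + (f x.val).time := rfl

@[simp] theorem pure_val (a : α) : (pure a : Timed α).val = a := rfl

@[simp] theorem pure_time (a : α) : (pure a : Timed α).time = 0 := rfl

@[simp] theorem tick_time : Timed.tick.time = 1 := rfl

end Timed

section ListPrograms

variable {α : Type}

@[simp] theorem lengthT_val (l : List α) : (lengthT l).val = l.length := by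
  induction l with
  | nil => rfl
  | cons a l ih => simp [lengthT, ih]

@[simp] theorem lengthT_time (l : List α) : (lengthT l).time = l.length + 1 := by
  induction l with
  | nil => rfl
  | cons a l ih => simp [lengthT, ih]; omega

@[simp] theorem appendT_val (l l' : List α) : (appendT l l').val = l ++ l' := by
  induction l with
  | nil => rfl
  | cons a l ih => simp [appendT, ih]

@[simp] theorem appendT_time (l l' : List α) : (appendT l l').time = l.length + 1 := by
  induction l with
  | nil => rfl
  | cons a l ih => simp [appendT, ih]; omega

@[simp] theorem takeT_val (k : ℕ) (l : List α) : (takeT k l).val = l.take k := by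
  induction l generalizing k with
  | nil => cases k <;> rfl
  | cons a l ih => cases k <;> simp [takeT, ih]

theorem takeT_time_le (k : ℕ) (l : List α) : (takeT k l).time ≤ l.length + 1 := by
  induction l generalizing k with
  | nil => cases k <;> simp [takeT]
  | cons a l ih =>
    cases k with
    | zero => simp [takeT]
    | succ k => have := ih k; simp [takeT]; omega

@[simp] theorem unmarkedT_val (mark : α → Bool) (l : List α) :
    (unmarkedT mark l).val = l.filter (fun a => !mark a) := by
  induction l with
  | nil => rfl
  | cons a l ih => by_cases h : mark a <;> simp [unmarkedT, ih, h]

@[simp] theorem unmarkedT_time (mark : α → Bool) (l : List α) :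
    (unmarkedT mark l).time = l.length + 1 := by
  induction l with
  | nil => rfl
  | cons a l ih => simp [unmarkedT, ih]; omega

theorem markT_val_eq_true [DecidableEq α] (l : List α) (mark : α → Bool) (a : α) :
    (markT l mark).val a = true ↔ mark a = true ∨ a ∈ l := by
  induction l generalizing mark with
  | nil => simp [markT]
  | cons b l ih =>
    simp only [markT, Timed.bind_val, ih, Function.update_apply, List.mem_cons]
    by_cases h : a = b <;> simp [h]

@[simp] theorem markT_time [DecidableEq α] (l : List α) (mark : α → Bool) :
    (markT l mark).time = l.length + 1 := by
  induction l generalizing mark with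
  | nil => rfl
  | cons b l ih => simp [markT, ih]; omega

end ListPrograms

/-! ### Linear-time selection -/

section SelectionPrograms

variable {α β : Type} [LinearOrder β] (key : α → β)

theorem sortDesc_perm (l : List α) : (sortDesc key l).Perm l :=
  List.perm_insertionSort _ l

theorem sortDesc_pairwise (l : List α) :
    (sortDesc key l).Pairwise (fun a b => key b ≤ key a) := by
  have : Std.Total (fun a b => key b ≤ key a) := ⟨fun a b => le_total _ _⟩
  have : IsTrans α (fun a b => key b ≤ key a) := ⟨fun a b c h h' => h'.trans h⟩
  exact List.pairwise_insertionSort _ l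

@[simp] theorem sortDesc_length (l : List α) : (sortDesc key l).length = l.length :=
  (sortDesc_perm key l).length_eq

/-- `r` consists of `k` entries of `l` with the largest keys. -/
def IsHeaviest (k : ℕ) (l r : List α) : Prop :=
  r.length = k ∧ ∃ rest, (r ++ rest).Perm l ∧ ∀ a ∈ r, ∀ b ∈ rest, key b ≤ key a

theorem sortDesc_take_isHeaviest {k : ℕ} {l : List α} (hk : k ≤ l.length) :
    IsHeaviest key k l ((sortDesc key l).take k) := by
  refine ⟨by simp [hk], (sortDesc key l).drop k, ?_, ?_⟩
  · rw [List.take_append_drop]; exact sortDesc_perm key l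
  · have h := sortDesc_pairwise key l
    rw [← List.take_append_drop k (sortDesc key l), List.pairwise_append] at h
    exact h.2.2

@[simp] theorem mediansT_length (l : List α) : (mediansT key l).val.length = l.length / 5 := by
  induction l using mediansT.induct with
  | case1 a b c d e l ih => simp [mediansT, ih]; omega
  | case2 l h =>
    match l, h with
    | [], _ => simp [mediansT]
    | [_], _ => simp [mediansT]
    | [_, _], _ => simp [mediansT]
    | [_, _, _], _ => simp [mediansT]
    | [_, _, _, _], _ => simp [mediansT]
    | a :: b :: c :: d :: e :: l, h => exact absurd rfl (h a b c d e l)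

theorem mediansT_time (l : List α) : (mediansT key l).time = l.length / 5 + 1 := by
  induction l using mediansT.induct with
  | case1 a b c d e l ih => simp [mediansT, ih]; omega
  | case2 l h =>
    match l, h with
    | [], _ => simp [mediansT]
    | [_], _ => simp [mediansT]
    | [_, _], _ => simp [mediansT]
    | [_, _, _], _ => simp [mediansT]
    | [_, _, _, _], _ => simp [mediansT]
    | a :: b :: c :: d :: e :: l, h => exact absurd rfl (h a b c d e l)

/-- In a sorted group of five, two entries lie on each side of the median; either side together with
the median makes three. -/
theorem countP_median_five (p : β) (a b c d e : α) :
    (p ≤ key ((sortDesc key [a, b, c, d, e]).getD 2 c) →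
      3 ≤ [a, b, c, d, e].countP (fun x => p ≤ key x)) ∧
    (key ((sortDesc key [a, b, c, d, e]).getD 2 c) ≤ p →
      3 ≤ [a, b, c, d, e].countP (fun x => key x ≤ p)) := by
  have hp := sortDesc_perm key [a, b, c, d, e]
  have hs := sortDesc_pairwise key [a, b, c, d, e]
  have hl := sortDesc_length key [a, b, c, d, e]
  rw [← hp.countP_eq, ← hp.countP_eq]
  generalize sortDesc key [a, b, c, d, e] = s at *
  match s, hl with
  | [v, w, x, y, z], _ =>
    simp only [List.pairwise_cons, List.mem_cons, forall_eq_or_imp, List.not_mem_nil,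
      false_imp_iff, implies_true, and_true] at hs
    obtain ⟨⟨-, h1, -, -⟩, ⟨h2, -, -⟩, ⟨h3, h4⟩, -⟩ := hs
    constructor
    · intro h
      replace h : p ≤ key x := h
      simp only [List.countP_cons, h, h.trans h1, h.trans h2, decide_true, if_true]
      omega
    · intro h
      replace h : key x ≤ p := h
      simp only [List.countP_cons, h, h3.trans h, h4.trans h, decide_true, if_true]
      omega

/-- Summation over the groups; the entries of an incomplete last group can only enlarge the
right-hand sides. -/
theorem countP_mediansT (p : β) (l : List α) :
    3 * (mediansT key l).val.countP (fun x => p ≤ key x) ≤ l.countP (fun x => p ≤ key x) ∧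
    3 * (mediansT key l).val.countP (fun x => key x ≤ p) ≤ l.countP (fun x => key x ≤ p) := by
  induction l using mediansT.induct with
  | case1 a b c d e l ih =>
    have h := countP_median_five key p a b c d e
    have e1 : a :: b :: c :: d :: e :: l = [a, b, c, d, e] ++ l := rfl
    rw [e1, List.countP_append, List.countP_append]
    simp only [mediansT, List.cons_append, List.nil_append, Timed.bind_val, Timed.pure_val,
      List.countP_cons (a := List.getD _ _ _)]
    constructor
    · split_ifs with h1
      · have := h.1 (by simpa using h1)
        omega
      · omega
    · split_ifs with h1
      · have := h.2 (by simpa using h1)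
        omega
      · omega
  | case2 l h =>
    match l, h with
    | [], _ => simp [mediansT]
    | [_], _ => simp [mediansT]
    | [_, _], _ => simp [mediansT]
    | [_, _, _], _ => simp [mediansT]
    | [_, _, _, _], _ => simp [mediansT]
    | a :: b :: c :: d :: e :: l, h => exact absurd rfl (h a b c d e l)

theorem minKeyT_spec (p : β) (l : List α) :
    (minKeyT key p l).val ≤ p ∧ (∀ a ∈ l, (minKeyT key p l).val ≤ key a) ∧
    ((minKeyT key p l).val = p ∨ ∃ a ∈ l, key a = (minKeyT key p l).val) ∧
    (minKeyT key p l).time = l.length + 1 := by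
  induction l generalizing p with
  | nil => simp [minKeyT]
  | cons a l ih =>
    obtain ⟨h1, h2, h3, h4⟩ := ih (min p (key a))
    simp only [minKeyT, Timed.bind_val, Timed.bind_time, Timed.tick_time, List.length_cons, h4]
    refine ⟨h1.trans (min_le_left _ _), ?_, ?_, by omega⟩
    · intro b hb
      rcases List.mem_cons.1 hb with rfl | hb
      · exact h1.trans (min_le_right _ _)
      · exact h2 b hb
    · rcases h3 with h3 | ⟨b, hb, h3⟩
      · rcases le_total p (key a) with h | h
        · left; rw [h3, min_eq_left h]
        · right; exact ⟨a, by simp, by rw [h3, min_eq_right h]⟩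
      · exact Or.inr ⟨b, by simp [hb], h3⟩

theorem partitionT_val (p : β) (l : List α) :
    (partitionT key p l).val =
      (l.filter (fun x => p < key x), l.filter (fun x => key x = p),
        l.filter (fun x => key x < p)) := by
  induction l with
  | nil => rfl
  | cons a l ih =>
    simp only [partitionT, Timed.bind_val, ih]
    rcases lt_trichotomy p (key a) with h | h | h
    · simp [h, h.ne', h.not_gt]
    · simp [h]
    · simp [h, h.ne, h.not_gt]

theorem partitionT_time (p : β) (l : List α) :
    (partitionT key p l).time = l.length + 1 := by
  induction l with
  | nil => rfl
  | cons a l ih =>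
    simp only [partitionT, Timed.bind_time, ih, partitionT_val]
    split_ifs <;> simp <;> omega

theorem perm_filter_trichotomy (p : β) (l : List α) :
    (l.filter (fun x => p < key x) ++ (l.filter (fun x => key x = p) ++
      l.filter (fun x => key x < p))).Perm l := by
  induction l with
  | nil => simp
  | cons a l ih =>
    rcases lt_trichotomy p (key a) with h | h | h
    · simpa [h, h.ne', h.not_gt] using ih
    · simp only [h, lt_irrefl, decide_false, decide_true, List.filter_cons, if_true]
      rw [h] at ih
      simp only [List.cons_append]
      exact List.perm_middle.trans (ih.cons a)
    · simp only [h, h.ne, h.not_gt, decide_false, decide_true, List.filter_cons, if_true]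
      rw [← List.append_assoc] at ih ⊢
      exact List.perm_middle.trans (ih.cons a)

/-- The pivot is a median of the group medians, so about three tenths of the entries lie weakly on
each side of it. The recursive calls therefore receive about a fifth and at most about seven tenths
of the list. The missing tenth, times 200, leaves about 20 steps per entry for the linear passes,
and the cut-off at 25 absorbs the additive constants. The fuel suffices because both recursive lists
are strictly shorter. -/
theorem heaviestT_spec (fuel k : ℕ) (l : List α) (hl : l.length ≤ fuel) (hk : k ≤ l.length) :
    IsHeaviest key k l (heaviestT key fuel k l).val ∧
      (heaviestT key fuel k l).time ≤ 200 * l.length + 30 := by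
  induction fuel generalizing k l with
  | zero =>
    obtain rfl : l = [] := List.length_eq_zero_iff.1 (by omega)
    obtain rfl : k = 0 := by simpa using hk
    exact ⟨⟨rfl, [], by simp [heaviestT], by simp⟩, by simp [heaviestT]⟩
  | succ fuel ih =>
    by_cases h25 : l.length < 25
    · constructor
      · simp only [heaviestT, Timed.bind_val, lengthT_val, h25, if_true, Timed.pure_val]
        exact sortDesc_take_isHeaviest key hk
      · simp only [heaviestT, Timed.bind_time, lengthT_val, h25, if_true,
          Timed.pure_time, Timed.tick_time, lengthT_time]
        omega
    · have hq := mediansT_length key l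
      have hqt := mediansT_time key l
      have hcount := fun p => countP_mediansT key p l
      have hdef : heaviestT key (fuel + 1) k l = (do
        Timed.tick
        let len ← lengthT l
        if len < 25 then return (sortDesc key l).take k
        else
          let meds ← mediansT key l
          let q ← lengthT meds
          let top ← heaviestT key fuel ((q + 1) / 2) meds
          match top with
          | [] => return []
          | a :: top' =>
            let p ← minKeyT key (key a) top'
            let (gt, eq, lt) ← partitionT key p l
            let g ← lengthT gt
            let e ← lengthT eq
            if k ≤ g then heaviestT key fuel k gt
            else if k ≤ g + e then
              let r ← takeT (k - g) eq
              appendT gt r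
            else
              let r ← heaviestT key fuel (k - g - e) lt
              let s ← appendT eq r
              appendT gt s) := rfl
      rw [hdef]
      clear hdef
      set meds := (mediansT key l).val with hmeds
      have hmt := ih ((meds.length + 1) / 2) meds (by omega) (by omega)
      obtain ⟨⟨htl, rest, hperm, hrest⟩, htime⟩ := hmt
      set T := heaviestT key fuel ((meds.length + 1) / 2) meds with hT
      simp only [Timed.bind_val, Timed.bind_time, lengthT_val, lengthT_time, h25, if_false,
        ← hmeds, ← hT]
      cases htop : T.val with
      | nil => rw [htop] at htl; simp at htl; omega
      | cons a top' =>
        rw [htop] at htl hperm hrest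
        obtain ⟨hp1, hp2, hp3, hp4⟩ := minKeyT_spec key (key a) top'
        set p := (minKeyT key (key a) top').val with hp
        have hple : ∀ b ∈ a :: top', p ≤ key b := by
          intro b hb
          rcases List.mem_cons.1 hb with rfl | hb
          · exact hp1
          · exact hp2 b hb
        have hpatt : ∃ b ∈ a :: top', key b = p := by
          rcases hp3 with h | ⟨b, hb, h⟩
          · exact ⟨a, by simp, h.symm⟩
          · exact ⟨b, by simp [hb], h⟩
        -- The pivot is the minimum over the upper half of the medians: that whole half is at least
        -- `p`, while `rest` and an entry attaining the minimum are at most `p`.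
        have hc1 : (a :: top').length ≤ meds.countP (fun x => p ≤ key x) := by
          rw [← hperm.countP_eq, List.countP_append]
          have : (a :: top').countP (fun x => decide (p ≤ key x)) = (a :: top').length :=
            List.countP_eq_length.2 (fun b hb => by simpa using hple b hb)
          omega
        have hc2 : rest.length + 1 ≤ meds.countP (fun x => key x ≤ p) := by
          rw [← hperm.countP_eq, List.countP_append]
          obtain ⟨b, hb, hbp⟩ := hpatt
          have h1 : rest.countP (fun x => decide (key x ≤ p)) = rest.length :=
            List.countP_eq_length.2 (fun c hc => by
              have := hrest b hb c hc
              simpa [hbp] using this)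
          have h2 : 0 < (a :: top').countP (fun x => decide (key x ≤ p)) :=
            List.countP_pos_iff.2 ⟨b, hb, by simp [hbp]⟩
          omega
        have hrl : (a :: top').length + rest.length = meds.length := by
          rw [← List.length_append]; exact hperm.length_eq
        have htri := perm_filter_trichotomy key p l
        have hgt : ∀ b ∈ l.filter (fun x => decide (p < key x)), p < key b := by
          intro b hb; simpa using (List.mem_filter.1 hb).2
        have heq : ∀ b ∈ l.filter (fun x => decide (key x = p)), key b = p := by
          intro b hb; simpa using (List.mem_filter.1 hb).2
        have hlt : ∀ b ∈ l.filter (fun x => decide (key x < p)), key b < p := by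
          intro b hb; simpa using (List.mem_filter.1 hb).2
        have hlc : l.countP (fun x => decide (p ≤ key x)) + l.countP (fun x => decide (key x < p))
            = l.length := by
          have := List.length_eq_countP_add_countP (l := l) (fun x => decide (p ≤ key x))
          simp only [decide_eq_true_eq, not_le] at this
          exact this.symm
        have hgc : l.countP (fun x => decide (key x ≤ p)) + l.countP (fun x => decide (p < key x))
            = l.length := by
          have := List.length_eq_countP_add_countP (l := l) (fun x => decide (key x ≤ p))
          simp only [decide_eq_true_eq, not_le] at this
          exact this.symm
        rw [List.countP_eq_length_filter (p := fun x => decide (key x < p))] at hlc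
        rw [List.countP_eq_length_filter (p := fun x => decide (p < key x))] at hgc
        have hlen3 := htri.length_eq
        simp only [List.length_append] at hlen3
        have hcp := hcount p
        simp only [Timed.bind_val, Timed.bind_time, ← hp, hp4, partitionT_val, partitionT_time,
          lengthT_val, lengthT_time, Timed.tick_time, hqt]
        generalize l.filter (fun x => decide (p < key x)) = gt at *
        generalize l.filter (fun x => decide (key x = p)) = eq at *
        generalize l.filter (fun x => decide (key x < p)) = lt at *
        simp only [List.length_cons] at htl hc1 hrl
        split_ifs with hk1 hk2
        · obtain ⟨⟨h1, rest', h2, h3⟩, h4⟩ := ih k gt (by omega) hk1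
          refine ⟨⟨h1, rest' ++ (eq ++ lt), ?_, ?_⟩, ?_⟩
          · rw [← List.append_assoc]
            exact (h2.append_right _).trans htri
          · intro b hb c hc
            have hb' : b ∈ gt := h2.subset (List.mem_append_left _ hb)
            simp only [List.mem_append] at hc
            rcases hc with hc | hc | hc
            · exact h3 b hb c hc
            · rw [heq c hc]; exact (hgt b hb').le
            · exact (hlt c hc).le.trans (hgt b hb').le
          · omega
        · have ht := takeT_time_le (k - gt.length) eq
          simp only [Timed.bind_val, Timed.bind_time, appendT_val, takeT_val, appendT_time]
          refine ⟨⟨by simp; omega, eq.drop (k - gt.length) ++ lt, ?_, ?_⟩, by omega⟩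
          · rw [List.append_assoc, ← List.append_assoc (List.take _ _), List.take_append_drop]
            exact htri
          · intro b hb c hc
            simp only [List.mem_append] at hb hc
            have hb' : p ≤ key b := by
              rcases hb with hb | hb
              · exact (hgt b hb).le
              · exact (heq b (List.mem_of_mem_take hb)).ge
            have hc' : key c ≤ p := by
              rcases hc with hc | hc
              · exact (heq c (List.mem_of_mem_drop hc)).le
              · exact (hlt c hc).le
            exact hc'.trans hb'
        · obtain ⟨⟨h1, rest', h2, h3⟩, h4⟩ :=
            ih (k - gt.length - eq.length) lt (by omega) (by omega)
          simp only [Timed.bind_val, Timed.bind_time, appendT_val, appendT_time]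
          refine ⟨⟨by simp; omega, rest', ?_, ?_⟩, by omega⟩
          · rw [List.append_assoc, List.append_assoc]
            exact ((h2.append_left _).append_left _).trans htri
          · intro b hb c hc
            simp only [List.mem_append] at hb
            have hc' : c ∈ lt := h2.subset (List.mem_append_right _ hc)
            rcases hb with hb | hb | hb
            · exact (hlt c hc').le.trans (hgt b hb).le
            · exact (hlt c hc').le.trans (heq b hb).ge
            · exact h3 b hb c hc

end SelectionPrograms

/-! ### The lists of the pairs, and the coreset -/

section PairTableBasic

namespace PairTable

variable {V : Type}

/-- The empty table. -/
def empty : PairTable V := ⟨[], fun _ => []⟩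

/-- The list `pairs` lists the non-empty entries without repetition. -/
def Consistent (A : PairTable V) : Prop :=
  A.pairs.Nodup ∧ ∀ p, p ∈ A.pairs ↔ A.entry p ≠ []

theorem empty_consistent : (empty : PairTable V).Consistent := by
  simp [Consistent, empty]

end PairTable

end PairTableBasic

section Coreset

variable {V : Type} [LinearOrder V]

namespace PairTable

/-- Perform a list of insertions. -/
def pushAll (A : PairTable V) (l : List ((V × V) × Hyperarc V)) : PairTable V :=
  l.foldl (fun A q => A.push q.1 q.2) A

theorem pushAll_entry (A : PairTable V) (l : List ((V × V) × Hyperarc V)) (p : V × V) :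
    (A.pushAll l).entry p =
      ((l.filter (fun q => q.1 = p)).map Prod.snd).reverse ++ A.entry p := by
  induction l generalizing A with
  | nil => rfl
  | cons q l ih =>
    have : A.pushAll (q :: l) = (A.push q.1 q.2).pushAll l := rfl
    rw [this, ih]
    by_cases h : q.1 = p
    · simp [push, h]
    · simp [push, h, Function.update_of_ne (Ne.symm h)]

theorem Consistent.push {A : PairTable V} (h : A.Consistent) (p : V × V) (f : Hyperarc V) :
    (A.push p f).Consistent := by
  obtain ⟨h1, h2⟩ := h
  by_cases he : A.entry p = []
  · have hp : p ∉ A.pairs := fun hp => (h2 p).1 hp he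
    refine ⟨by simp [PairTable.push, he, hp, h1], fun q => ?_⟩
    by_cases hq : q = p
    · simp [PairTable.push, he, hq]
    · simp [PairTable.push, he, hq, h2]
  · refine ⟨by simp [PairTable.push, he, h1], fun q => ?_⟩
    by_cases hq : q = p
    · simp [PairTable.push, he, hq, h2]
    · simp [PairTable.push, he, hq, h2]

theorem Consistent.pushAll {A : PairTable V} (h : A.Consistent)
    (l : List ((V × V) × Hyperarc V)) : (A.pushAll l).Consistent := by
  induction l generalizing A with
  | nil => exact h
  | cons q l ih => exact ih (h.push q.1 q.2)

/-- This bounds the cost of all selections together: an insertion lengthens exactly one list, so the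
total is the sum of the biclique sizes. -/
theorem sum_length_entry_pushAll [Fintype V] (l : List ((V × V) × Hyperarc V)) :
    (((empty : PairTable V).pushAll l).pairs.map
      (fun p => (((empty : PairTable V).pushAll l).entry p).length)).sum = l.length := by
  set A := (empty : PairTable V).pushAll l with hA
  have hc : A.Consistent := empty_consistent.pushAll l
  rw [← List.sum_toFinset _ hc.1]
  rw [Finset.sum_subset (Finset.subset_univ _)]
  · have : ∀ p, (A.entry p).length = l.countP (fun q => q.1 = p) := by
      intro p
      rw [hA, pushAll_entry, List.countP_eq_length_filter]
      simp [empty]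
    simp only [this]
    clear this hc hA
    induction l with
    | nil => simp
    | cons q l ih => simp [List.countP_cons, Finset.sum_add_distrib, ih]
  · intro p _ hp
    rw [List.mem_toFinset, hc.2 p, not_not] at hp
    simp [hp]

end PairTable

/-- The insertions that a hyperarc gives rise to. -/
def arcInsertions (f : Hyperarc V) : List ((V × V) × Hyperarc V) :=
  (f.tail.sort (· ≤ ·)).flatMap (fun u => (f.head.sort (· ≤ ·)).map (fun v => ((u, v), f)))

theorem mem_arcInsertions {f : Hyperarc V} {q : (V × V) × Hyperarc V} :
    q ∈ arcInsertions f ↔ q.1 ∈ f.biclique ∧ q.2 = f := by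
  obtain ⟨⟨u, v⟩, g⟩ := q
  simp only [arcInsertions, List.mem_flatMap, Finset.mem_sort, List.mem_map, Prod.mk.injEq,
    Hyperarc.biclique, Finset.mem_product]
  constructor
  · rintro ⟨a, ha, b, hb, ⟨rfl, rfl⟩, rfl⟩
    exact ⟨⟨ha, hb⟩, rfl⟩
  · rintro ⟨⟨ha, hb⟩, rfl⟩
    exact ⟨u, ha, v, hb, ⟨rfl, rfl⟩, rfl⟩

theorem arcInsertions_nodup (f : Hyperarc V) : (arcInsertions f).Nodup := by
  unfold arcInsertions
  rw [List.nodup_flatMap]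
  refine ⟨fun u _ => (Finset.sort_nodup _ _).map (fun a b h => by simpa using h), ?_⟩
  refine (Finset.sort_nodup f.tail (· ≤ ·)).imp ?_
  intro a b hab q hq1 hq2
  simp only [List.mem_map] at hq1 hq2
  obtain ⟨v, -, rfl⟩ := hq1
  obtain ⟨w, -, h⟩ := hq2
  simp only [Prod.mk.injEq] at h
  exact hab h.1.1.symm

theorem arcInsertions_length (f : Hyperarc V) :
    (arcInsertions f).length = f.tail.card * f.head.card := by
  simp [arcInsertions, List.length_flatMap]

theorem flatMap_arcInsertions_nodup {L : List (Hyperarc V)} (hL : L.Nodup) :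
    (L.flatMap arcInsertions).Nodup := by
  rw [List.nodup_flatMap]
  refine ⟨fun f _ => arcInsertions_nodup f, hL.imp ?_⟩
  intro f g hfg q hq1 hq2
  rw [mem_arcInsertions] at hq1 hq2
  exact hfg (hq1.2.symm.trans hq2.2)

theorem insertHeadsT_val (f : Hyperarc V) (u : V) (vs : List V) (A : PairTable V) :
    (insertHeadsT f u vs A).val = A.pushAll (vs.map (fun v => ((u, v), f))) := by
  induction vs generalizing A with
  | nil => rfl
  | cons v vs ih => simp only [insertHeadsT, Timed.bind_val, ih]; rfl

theorem insertHeadsT_time (f : Hyperarc V) (u : V) (vs : List V) (A : PairTable V) :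
    (insertHeadsT f u vs A).time = vs.length + 1 := by
  induction vs generalizing A with
  | nil => rfl
  | cons v vs ih =>
    simp only [insertHeadsT, Timed.bind_time, ih, Timed.tick_time, List.length_cons]; omega

theorem insertTailsT_val (f : Hyperarc V) (us : List V) (A : PairTable V) :
    (insertTailsT f us A).val = A.pushAll
      (us.flatMap (fun u => (f.head.sort (· ≤ ·)).map (fun v => ((u, v), f)))) := by
  induction us generalizing A with
  | nil => rfl
  | cons v vs ih =>
    simp only [insertTailsT, Timed.bind_val, ih, insertHeadsT_val, List.flatMap_cons,
      PairTable.pushAll, List.foldl_append]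

theorem insertTailsT_time (f : Hyperarc V) (us : List V) (A : PairTable V) :
    (insertTailsT f us A).time = us.length * (f.head.card + 2) + 1 := by
  induction us generalizing A with
  | nil => simp [insertTailsT]
  | cons v vs ih =>
    simp only [insertTailsT, Timed.bind_time, ih, insertHeadsT_time, Timed.tick_time,
      List.length_cons, Finset.length_sort]
    ring

theorem buildTableT_val (L : List (Hyperarc V)) (A : PairTable V) :
    (buildTableT L A).val = A.pushAll (L.flatMap arcInsertions) := by
  induction L generalizing A with
  | nil => rfl
  | cons f L ih =>
    simp only [buildTableT, Timed.bind_val, ih, insertTailsT_val, List.flatMap_cons,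
      PairTable.pushAll, List.foldl_append]
    rfl

theorem buildTableT_time_le {W : ℕ} {L : List (Hyperarc V)}
    (hW : ∀ f ∈ L, f.tail.card * f.head.card ≤ W) (A : PairTable V) :
    (buildTableT L A).time ≤ 5 * (L.length * W) + 1 := by
  induction L generalizing A with
  | nil => simp [buildTableT]
  | cons f L ih =>
    have h1 := ih (fun g hg => hW g (by simp [hg])) (insertTailsT f (f.tail.sort (· ≤ ·)) A).val
    have h2 := hW f (by simp)
    have ht : 1 ≤ f.tail.card := f.2.1.card_pos
    have hh : 1 ≤ f.head.card := f.2.2.card_pos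
    simp only [buildTableT, Timed.bind_time, insertTailsT_time, Timed.tick_time,
      List.length_cons, Finset.length_sort]
    nlinarith

/-- Take for `D p` the hyperarcs newly marked while `p` is processed; those marked before are
filtered out first, whence disjointness. A hyperarc in the list of `p` that is unmarked at the end
was a candidate at that moment and was not taken, so `lam` others at least as heavy were. With fewer
than `lam` candidates, all are taken and none remains unmarked. -/
theorem coresetLoopT_spec (z : Hyperarc V → ℝ≥0) (lam : ℕ) (A : PairTable V)
    (ps : List (V × V)) (hps : ps.Nodup) (hA : ∀ p, (A.entry p).Nodup) (S : Hyperarc V → Bool) :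
    (∃ D : V × V → Finset (Hyperarc V),
      (∀ p, (D p).card ≤ lam) ∧ (∀ p, p ∉ ps → D p = ∅) ∧
      (∀ p, ∀ f ∈ D p, f ∈ A.entry p ∧ S f = false) ∧
      (∀ p p', p ≠ p' → Disjoint (D p) (D p')) ∧
      (∀ f, (coresetLoopT z lam A ps S).val f = true ↔ S f = true ∨ ∃ p, f ∈ D p) ∧
      (∀ p ∈ ps, ∀ f ∈ A.entry p, (coresetLoopT z lam A ps S).val f = false →
        (D p).card = lam ∧ ∀ g ∈ D p, z f ≤ z g)) ∧
    (coresetLoopT z lam A ps S).time ≤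
      204 * (ps.map (fun p => (A.entry p).length)).sum + 40 * ps.length + 1 := by
  induction ps generalizing S with
  | nil =>
    exact ⟨⟨fun _ => ∅, by simp, by simp, by simp, by simp, by simp [coresetLoopT], by simp⟩,
      by simp [coresetLoopT]⟩
  | cons p ps ih =>
    obtain ⟨hp, hps'⟩ := List.nodup_cons.1 hps
    set B := (A.entry p).filter (fun a => !S a) with hB
    have hBn : B.Nodup := (hA p).filter _
    have hBl : B.length ≤ (A.entry p).length := List.length_filter_le _ _
    obtain ⟨Sp, t, hval, hSpB, hSpn, hSpl, hSph, htime, ht⟩ :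
        ∃ (Sp : List (Hyperarc V)) (t : ℕ),
          (coresetLoopT z lam A (p :: ps) S).val
            = (coresetLoopT z lam A ps (markT Sp S).val).val ∧
          Sp ⊆ B ∧ Sp.Nodup ∧ Sp.length ≤ lam ∧
          (∀ f ∈ B, f ∉ Sp → Sp.length = lam ∧ ∀ g ∈ Sp, z f ≤ z g) ∧
          (coresetLoopT z lam A (p :: ps) S).time
            = t + (coresetLoopT z lam A ps (markT Sp S).val).time ∧
          t ≤ 204 * (A.entry p).length + 40 := by
      by_cases hlam : lam ≤ B.length
      · obtain ⟨⟨h1, rest, h2, h3⟩, h4⟩ := heaviestT_spec z B.length lam B le_rfl hlam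
        have hn := h2.symm.nodup hBn
        refine ⟨(heaviestT z B.length lam B).val, 1 + ((A.entry p).length + 1) + (B.length + 1)
          + (heaviestT z B.length lam B).time
          + ((heaviestT z B.length lam B).val.length + 1), ?_, ?_, ?_, h1.le, ?_, ?_, ?_⟩
        · simp only [coresetLoopT, Timed.bind_val, unmarkedT_val, lengthT_val, ← hB, if_pos hlam]
        · exact fun f hf => h2.subset (List.mem_append_left _ hf)
        · exact hn.of_append_left
        · intro f hf hfS
          refine ⟨h1, fun g hg => ?_⟩
          rcases List.mem_append.1 (h2.symm.subset hf) with h | h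
          · exact absurd h hfS
          · exact h3 g hg f h
        · simp only [coresetLoopT, Timed.bind_time, unmarkedT_val, lengthT_val,
            ← hB, if_pos hlam, unmarkedT_time, lengthT_time, markT_time, Timed.tick_time]
          omega
        · omega
      · refine ⟨B, 1 + ((A.entry p).length + 1) + (B.length + 1) + (B.length + 1), ?_,
          fun _ h => h, hBn, by omega, fun f hf hf' => absurd hf hf', ?_, by omega⟩
        · simp only [coresetLoopT, Timed.bind_val, unmarkedT_val, lengthT_val, ← hB, if_neg hlam]
        · simp only [coresetLoopT, Timed.bind_time, unmarkedT_val, lengthT_val,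
            ← hB, if_neg hlam, unmarkedT_time, lengthT_time, markT_time, Timed.tick_time]
          omega
    obtain ⟨⟨D, hD1, hD2, hD3, hD4, hD5, hD6⟩, hDt⟩ := ih hps' (markT Sp S).val
    have hmem : ∀ f ∈ Sp, f ∈ A.entry p ∧ S f = false := by
      intro f hf
      simpa [hB] using List.mem_filter.1 (hSpB hf)
    have hDS : ∀ q, ∀ f ∈ D q, f ∉ Sp ∧ S f = false := by
      intro q f hf
      have h := (hD3 q f hf).2
      rw [← Bool.not_eq_true, markT_val_eq_true] at h
      push Not at h
      exact ⟨h.2, by simpa using h.1⟩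
    constructor
    · refine ⟨Function.update D p Sp.toFinset, ?_, ?_, ?_, ?_, ?_, ?_⟩
      · intro q
        by_cases h : q = p
        · subst h; simpa [List.toFinset_card_of_nodup hSpn] using hSpl
        · simpa [h] using hD1 q
      · intro q hq
        simp only [List.mem_cons, not_or] at hq
        simpa [hq.1] using hD2 q hq.2
      · intro q f hf
        by_cases h : q = p
        · subst h
          exact hmem f (by simpa using hf)
        · rw [Function.update_of_ne h] at hf
          exact ⟨(hD3 q f hf).1, (hDS q f hf).2⟩
      · intro q q' hqq
        by_cases h : q = p
        · subst h
          rw [Function.update_self, Function.update_of_ne hqq.symm, Finset.disjoint_left]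
          intro f hf hf'
          exact (hDS q' f hf').1 (by simpa using hf)
        · by_cases h' : q' = p
          · subst h'
            rw [Function.update_self, Function.update_of_ne hqq, Finset.disjoint_left]
            intro f hf hf'
            exact (hDS q f hf).1 (by simpa using hf')
          · rw [Function.update_of_ne h, Function.update_of_ne h']
            exact hD4 q q' hqq
      · intro f
        rw [hval, hD5, markT_val_eq_true]
        constructor
        · rintro ((h | h) | ⟨q, h⟩)
          · exact Or.inl h
          · exact Or.inr ⟨p, by simpa using h⟩
          · have hq : q ≠ p := by
              rintro rfl
              rw [hD2 q hp] at h
              simp at h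
            exact Or.inr ⟨q, by rwa [Function.update_of_ne hq]⟩
        · rintro (h | ⟨q, h⟩)
          · exact Or.inl (Or.inl h)
          · by_cases hq : q = p
            · subst hq
              exact Or.inl (Or.inr (by simpa using h))
            · rw [Function.update_of_ne hq] at h
              exact Or.inr ⟨q, h⟩
      · intro q hq f hf hfS
        rw [hval] at hfS
        by_cases h : q = p
        · subst h
          have h1 : ¬ ((markT Sp S).val f = true) := fun h => by
            have := (hD5 f).2 (Or.inl h)
            rw [hfS] at this
            simp at this
          rw [markT_val_eq_true] at h1
          push Not at h1
          have hfB : f ∈ B := by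
            rw [hB, List.mem_filter]; exact ⟨hf, by simpa using h1.1⟩
          have := hSph f hfB h1.2
          simpa [List.toFinset_card_of_nodup hSpn] using this
        · rw [Function.update_of_ne h]
          exact hD6 q (by simpa [h] using hq) f hf hfS
    · rw [htime]
      simp only [List.map_cons, List.sum_cons, List.length_cons]
      omega

/-- The set `S` is made up of disjoint sets `D p`, each of at most `lam` hyperarcs of `L` whose
bicliques contain `p`; if some hyperarc outside `S` has `p` in its biclique, then `D p` consists
of `lam` hyperarcs that are at least as heavy. -/
structure IsCoreset (L : List (Hyperarc V)) (z : Hyperarc V → ℝ≥0) (lam : ℕ)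
    (S : Hyperarc V → Bool) (D : V × V → Finset (Hyperarc V)) : Prop where
  card_le : ∀ p, (D p).card ≤ lam
  mem : ∀ p, ∀ f ∈ D p, f ∈ L ∧ p ∈ f.biclique
  disjoint : ∀ p p', p ≠ p' → Disjoint (D p) (D p')
  marked_iff : ∀ f, S f = true ↔ ∃ p, f ∈ D p
  card_eq : ∀ f ∈ L, S f = false → ∀ p ∈ f.biclique, (D p).card = lam
  weight_le : ∀ f ∈ L, S f = false → ∀ p ∈ f.biclique, ∀ g ∈ D p, z f ≤ z g

theorem coresetFinder_spec [Fintype V] {L : List (Hyperarc V)} (hL : L.Nodup)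
    (z : Hyperarc V → ℝ≥0) (lam : ℕ) :
    ∃ D, IsCoreset L z lam (coresetFinder L z lam).val D := by
  set A := (PairTable.empty : PairTable V).pushAll (L.flatMap arcInsertions) with hAdef
  have hval : (coresetFinder L z lam).val
      = (coresetLoopT z lam A A.pairs (fun _ => false)).val := by
    simp only [coresetFinder, Timed.bind_val, buildTableT_val]; rfl
  have hAc : A.Consistent := PairTable.empty_consistent.pushAll _
  have hent : ∀ p, A.entry p
      = (((L.flatMap arcInsertions).filter (fun q => q.1 = p)).map Prod.snd).reverse := by
    intro p
    rw [hAdef, PairTable.pushAll_entry]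
    simp [PairTable.empty]
  have hmem : ∀ p f, f ∈ A.entry p ↔ f ∈ L ∧ p ∈ f.biclique := by
    intro p f
    rw [hent]
    simp only [List.mem_reverse, List.mem_map, List.mem_filter, List.mem_flatMap,
      mem_arcInsertions, decide_eq_true_eq]
    constructor
    · rintro ⟨⟨q, g⟩, ⟨⟨f', h1, h2, h3⟩, h4⟩, h5⟩
      simp only at h2 h3 h4 h5
      subst h3 h4 h5
      exact ⟨h1, h2⟩
    · rintro ⟨h1, h2⟩
      exact ⟨(p, f), ⟨⟨f, h1, h2, rfl⟩, rfl⟩, rfl⟩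
  have hnd : ∀ p, (A.entry p).Nodup := by
    intro p
    rw [hent, List.nodup_reverse]
    refine List.Nodup.map_on ?_ ((flatMap_arcInsertions_nodup hL).filter _)
    intro x hx y hy hxy
    have h1 := (List.mem_filter.1 hx).2
    have h2 := (List.mem_filter.1 hy).2
    simp only [decide_eq_true_eq] at h1 h2
    exact Prod.ext (h1.trans h2.symm) hxy
  obtain ⟨⟨D, h1, -, h3, h4, h5, h6⟩, -⟩ :=
    coresetLoopT_spec z lam A A.pairs hAc.1 hnd (fun _ => false)
  rw [← hval] at h5 h6
  have h7 : ∀ f ∈ L, (coresetFinder L z lam).val f = false → ∀ p ∈ f.biclique,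
      (D p).card = lam ∧ ∀ g ∈ D p, z f ≤ z g := by
    intro f hf hS p hp
    have hfe := (hmem p f).2 ⟨hf, hp⟩
    exact h6 p ((hAc.2 p).2 (List.ne_nil_of_mem hfe)) f hfe hS
  exact ⟨D, h1, fun p f hf => (hmem p f).1 (h3 p f hf).1, h4, by simpa using h5,
    fun f hf hS p hp => (h7 f hf hS p hp).1, fun f hf hS p hp => (h7 f hf hS p hp).2⟩

theorem coresetFinder_time_le [Fintype V] {L : List (Hyperarc V)} (hL : L.Nodup)
    (z : Hyperarc V → ℝ≥0) (lam : ℕ) {W : ℕ}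
    (hW : ∀ f ∈ L, f.tail.card * f.head.card ≤ W) :
    (coresetFinder L z lam).time ≤ 249 * (L.length * W) + 3 := by
  set A := (PairTable.empty : PairTable V).pushAll (L.flatMap arcInsertions) with hAdef
  have htime : (coresetFinder L z lam).time
      = 1 + ((buildTableT L PairTable.empty).time
        + (coresetLoopT z lam A A.pairs (fun _ => false)).time) := by
    have : A = (buildTableT L PairTable.empty).val := (buildTableT_val L _).symm
    rw [this]
    rfl
  have hAc : A.Consistent := PairTable.empty_consistent.pushAll _
  have hnd : ∀ p, (A.entry p).Nodup := by
    intro p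
    rw [hAdef, PairTable.pushAll_entry]
    simp only [PairTable.empty, List.append_nil]
    rw [List.nodup_reverse]
    refine List.Nodup.map_on ?_ ((flatMap_arcInsertions_nodup hL).filter _)
    intro x hx y hy hxy
    have h1 := (List.mem_filter.1 hx).2
    have h2 := (List.mem_filter.1 hy).2
    simp only [decide_eq_true_eq] at h1 h2
    exact Prod.ext (h1.trans h2.symm) hxy
  have h1 := (coresetLoopT_spec z lam A A.pairs hAc.1 hnd (fun _ => false)).2
  have h2 := PairTable.sum_length_entry_pushAll (L.flatMap arcInsertions)
  rw [← hAdef] at h2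
  -- Only pairs with a non-empty list are visited, so the overhead per pair is also charged to the
  -- insertions.
  have h3 : A.pairs.length ≤ (A.pairs.map (fun p => (A.entry p).length)).sum := by
    have := List.length_le_sum_of_one_le (A.pairs.map (fun p => (A.entry p).length))
      (by
        intro i hi
        obtain ⟨p, hp, rfl⟩ := List.mem_map.1 hi
        exact List.length_pos_iff.2 ((hAc.2 p).1 hp))
    simpa using this
  have h4 : (L.flatMap arcInsertions).length ≤ L.length * W := by
    rw [List.length_flatMap]
    have := List.sum_le_card_nsmul (L.map (fun f => (arcInsertions f).length)) W
      (by
        intro i hi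
        obtain ⟨f, hf, rfl⟩ := List.mem_map.1 hi
        simpa only [arcInsertions_length] using hW f hf)
    simpa using this
  have h5 := buildTableT_time_le hW PairTable.empty
  omega

/-- The number of the hyperarcs of a coreset. -/
theorem IsCoreset.card_marked_le [Fintype V] {L : List (Hyperarc V)} {z : Hyperarc V → ℝ≥0}
    {lam : ℕ} {S : Hyperarc V → Bool} {D : V × V → Finset (Hyperarc V)}
    (h : IsCoreset L z lam S D) :
    (L.toFinset.filter (fun f => S f = true)).card ≤ Fintype.card V ^ 2 * lam := by
  have hsub : L.toFinset.filter (fun f => S f = true) ⊆ Finset.univ.biUnion D := by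
    intro f hf
    obtain ⟨p, hp⟩ := (h.marked_iff f).1 (Finset.mem_filter.1 hf).2
    exact Finset.mem_biUnion.2 ⟨p, Finset.mem_univ _, hp⟩
  refine (Finset.card_le_card hsub).trans (Finset.card_biUnion_le.trans ?_)
  refine (Finset.sum_le_card_nsmul _ _ lam (fun p _ => h.card_le p)).trans (le_of_eq ?_)
  simp [sq]

end Coreset

/-! ### Expectations and union bounds for randomised computations -/

/-- The expectation of a non-negative function. -/
def PMF.expect {β : Type} (X : PMF β) (φ : β → ℝ≥0∞) : ℝ≥0∞ := ∑' b, X b * φ b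

namespace PMF

variable {β γ : Type}

theorem expect_pure (b : β) (φ : β → ℝ≥0∞) : (PMF.pure b).expect φ = φ b := by
  unfold expect
  rw [tsum_eq_single b]
  · simp
  · intro c hc; simp [PMF.pure_apply, hc]

theorem expect_bind (X : PMF β) (f : β → PMF γ) (φ : γ → ℝ≥0∞) :
    (X.bind f).expect φ = X.expect (fun b => (f b).expect φ) := by
  simp only [expect, PMF.bind_apply, ← ENNReal.tsum_mul_right, ← ENNReal.tsum_mul_left]
  rw [ENNReal.tsum_comm]
  simp only [mul_assoc]

theorem expect_map (X : PMF β) (g : β → γ) (φ : γ → ℝ≥0∞) :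
    (X.map g).expect φ = X.expect (fun b => φ (g b)) := by
  unfold PMF.map
  rw [expect_bind]
  simp [expect_pure]

theorem expect_mono {X : PMF β} {φ ψ : β → ℝ≥0∞} (h : ∀ b ∈ X.support, φ b ≤ ψ b) :
    X.expect φ ≤ X.expect ψ := by
  refine ENNReal.tsum_le_tsum fun b => ?_
  by_cases hb : b ∈ X.support
  · exact mul_le_mul_right (h b hb) _
  · rw [PMF.mem_support_iff, not_not] at hb
    simp [hb]

theorem expect_const (X : PMF β) (c : ℝ≥0∞) : X.expect (fun _ => c) = c := by
  simp [expect, ENNReal.tsum_mul_right, PMF.tsum_coe]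

theorem expect_const_mul (X : PMF β) (c : ℝ≥0∞) (φ : β → ℝ≥0∞) :
    X.expect (fun b => c * φ b) = c * X.expect φ := by
  simp only [expect, ← ENNReal.tsum_mul_left]
  exact tsum_congr fun b => by ring

theorem expect_add (X : PMF β) (φ ψ : β → ℝ≥0∞) :
    X.expect (fun b => φ b + ψ b) = X.expect φ + X.expect ψ := by
  simp only [expect, mul_add, ENNReal.tsum_add]

theorem toOuterMeasure_eq_expect (X : PMF β) (E : Set β) :
    X.toOuterMeasure E = X.expect (E.indicator 1) := by
  rw [PMF.toOuterMeasure_apply, expect]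
  refine tsum_congr fun b => ?_
  by_cases h : b ∈ E <;> simp [h]

theorem toOuterMeasure_le_one (X : PMF β) (E : Set β) : X.toOuterMeasure E ≤ 1 := by
  rw [toOuterMeasure_eq_expect]
  refine (expect_mono (ψ := fun _ => 1) fun b _ => ?_).trans (expect_const _ _).le
  by_cases h : b ∈ E <;> simp [h]

/-- Markov's inequality, multiplied out. -/
theorem toOuterMeasure_mul_le_expect (X : PMF β) {E : Set β} {φ : β → ℝ≥0∞} {c : ℝ≥0∞}
    (h : ∀ b ∈ E, c ≤ φ b) : c * X.toOuterMeasure E ≤ X.expect φ := by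
  rw [toOuterMeasure_eq_expect, ← expect_const_mul]
  refine expect_mono fun b _ => ?_
  by_cases hb : b ∈ E
  · simpa [hb] using h b hb
  · simp [hb]

end PMF

namespace Comp

variable {α β : Type}

/-- The law of a computation. -/
def law (X : Comp α) : PMF (α × ℕ) := X

theorem law_bind (X : Comp α) (f : α → Comp β) :
    (X >>= f).law = X.law.bind fun p => (f p.1).law.map (fun q => (q.1, p.2 + q.2)) := rfl

theorem law_pure (a : α) : (pure a : Comp α).law = PMF.pure (a, 0) := rfl

theorem law_lift (x : Timed α) : (lift x).law = PMF.pure (x.val, x.time) := rfl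

theorem law_lift_bind (x : Timed α) (f : α → Comp β) :
    (lift x >>= f).law = (f x.val).law.map (fun q => (q.1, x.time + q.2)) := by
  rw [law_bind, law_lift, PMF.pure_bind]

theorem law_coin_bind (f : Bool → Comp β) (φ : β × ℕ → ℝ≥0∞) :
    (coin >>= f).law.expect φ =
      2⁻¹ * (f true).law.expect (fun q => φ (q.1, 1 + q.2)) +
      2⁻¹ * (f false).law.expect (fun q => φ (q.1, 1 + q.2)) := by
  rw [law_bind, PMF.expect_bind]
  have : coin.law = PMF.map (fun b => (b, 1)) (PMF.uniformOfFintype Bool) := rfl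
  have huniform : ∀ ψ : Bool → ℝ≥0∞,
      (PMF.uniformOfFintype Bool).expect ψ = 2⁻¹ * ψ true + 2⁻¹ * ψ false := by
    intro ψ; simp [PMF.expect, tsum_fintype]
  rw [this, PMF.expect_map, huniform]
  simp only [PMF.expect_map]

theorem support_bind {X : Comp α} {f : α → Comp β} {q : β × ℕ}
    (hq : q ∈ (X >>= f).law.support) :
    ∃ p ∈ X.law.support, ∃ r ∈ (f p.1).law.support, q = (r.1, p.2 + r.2) := by
  rw [law_bind, PMF.mem_support_bind_iff] at hq
  obtain ⟨p, hp, hq⟩ := hq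
  rw [PMF.mem_support_map_iff] at hq
  obtain ⟨r, hr, rfl⟩ := hq
  exact ⟨p, hp, r, hr, rfl⟩

theorem support_lift_bind {x : Timed α} {f : α → Comp β} {q : β × ℕ}
    (hq : q ∈ (lift x >>= f).law.support) :
    ∃ r ∈ (f x.val).law.support, q = (r.1, x.time + r.2) := by
  obtain ⟨p, hp, r, hr, rfl⟩ := support_bind hq
  rw [law_lift, PMF.support_pure, Set.mem_singleton_iff] at hp
  subst hp
  exact ⟨r, hr, rfl⟩

theorem support_coin_bind {f : Bool → Comp β} {q : β × ℕ}
    (hq : q ∈ (coin >>= f).law.support) :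
    ∃ b, ∃ r ∈ (f b).law.support, q = (r.1, 1 + r.2) := by
  obtain ⟨p, hp, r, hr, rfl⟩ := support_bind hq
  have : coin.law = PMF.map (fun b => (b, 1)) (PMF.uniformOfFintype Bool) := rfl
  rw [this, PMF.mem_support_map_iff] at hp
  obtain ⟨b, -, rfl⟩ := hp
  exact ⟨b, r, hr, rfl⟩

theorem support_pure {a : α} {q : α × ℕ} (hq : q ∈ (pure a : Comp α).law.support) :
    q = (a, 0) := by
  rwa [law_pure, PMF.support_pure, Set.mem_singleton_iff] at hq

/-- A bad intermediate result is charged with its own probability; after any other one the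
continuation fails with probability at most `δ`. This lets failures of successive rounds be added
although the rounds depend on each other. -/
theorem toOuterMeasure_bind_le {X : Comp α} {f : α → Comp β} {E : Set (β × ℕ)}
    (A : Set (α × ℕ)) (δ : ℝ≥0∞)
    (h : ∀ p ∈ X.law.support, p ∉ A →
      (f p.1).law.toOuterMeasure {q | (q.1, p.2 + q.2) ∈ E} ≤ δ) :
    (X >>= f).law.toOuterMeasure E ≤ X.law.toOuterMeasure A + δ := by
  rw [law_bind, PMF.toOuterMeasure_eq_expect, PMF.expect_bind,
    PMF.toOuterMeasure_eq_expect X.law, ← PMF.expect_const X.law δ, ← PMF.expect_add]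
  refine PMF.expect_mono fun p hp => ?_
  rw [← PMF.toOuterMeasure_eq_expect]
  by_cases hpA : p ∈ A
  · rw [Set.indicator_of_mem hpA]
    exact le_add_right (PMF.toOuterMeasure_le_one _ _)
  · rw [PMF.toOuterMeasure_map_apply]
    exact le_add_left (h p hp hpA)

theorem toOuterMeasure_lift_bind (x : Timed α) (f : α → Comp β) (E : Set (β × ℕ)) :
    (lift x >>= f).law.toOuterMeasure E =
      (f x.val).law.toOuterMeasure {q | (q.1, x.time + q.2) ∈ E} := by
  rw [law_lift_bind, PMF.toOuterMeasure_map_apply]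
  rfl

theorem toOuterMeasure_pure {a : α} {E : Set (α × ℕ)} (h : (a, 0) ∉ E) :
    (pure a : Comp α).law.toOuterMeasure E = 0 := by
  rw [law_pure, PMF.toOuterMeasure_pure_apply, if_neg h]

theorem one_sub_le_prob {X : Comp α} {E : Set (α × ℕ)} {δ : ℝ} (hδ : 0 ≤ δ)
    (h : X.law.toOuterMeasure Eᶜ ≤ ENNReal.ofReal δ) : 1 - δ ≤ X.prob E := by
  have h1 : (1 : ℝ≥0∞) ≤ X.law.toOuterMeasure E + X.law.toOuterMeasure Eᶜ := by
    rw [PMF.toOuterMeasure_eq_expect, PMF.toOuterMeasure_eq_expect, ← PMF.expect_add,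
      ← PMF.expect_const X.law 1]
    refine PMF.expect_mono fun b _ => ?_
    by_cases hb : b ∈ E <;> simp [hb]
  have h2 : X.law.toOuterMeasure E ≠ ⊤ :=
    ne_top_of_le_ne_top ENNReal.one_ne_top (PMF.toOuterMeasure_le_one _ _)
  have h3 := ENNReal.toReal_mono (by finiteness) (h1.trans (add_le_add_right h _))
  rw [ENNReal.toReal_add h2 ENNReal.ofReal_ne_top, ENNReal.toReal_ofReal hδ] at h3
  simp only [ENNReal.toReal_one] at h3
  have h4 : X.prob E = (X.law.toOuterMeasure E).toReal := rfl
  linarith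

end Comp

/-! ### The random signs: exponential moments and tails -/

section Sampling

variable {V : Type} [LinearOrder V]

theorem sampleArcs_cons_of_marked {S : Hyperarc V → Bool} {f : Hyperarc V} (hf : S f = true)
    (l : List (Hyperarc V)) (z : Hyperarc V → ℝ≥0) :
    sampleArcs S (f :: l) z = (do
      Comp.lift Timed.tick
      let r ← sampleArcs S l z
      return (f :: r.1, r.2)) := by
  simp only [sampleArcs, hf, if_true]

theorem sampleArcs_cons_of_not_marked {S : Hyperarc V → Bool} {f : Hyperarc V}
    (hf : S f = false) (l : List (Hyperarc V)) (z : Hyperarc V → ℝ≥0) :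
    sampleArcs S (f :: l) z = (do
      Comp.lift Timed.tick
      let b ← Comp.coin
      if b then
        let r ← sampleArcs S l (Function.update z f (2 * z f))
        return (f :: r.1, r.2)
      else sampleArcs S l z) := by
  simp only [sampleArcs, hf, Bool.false_eq_true, if_false]

/-- Without repetitions in `l`, each hyperarc is treated once and its weight is doubled at most
once. These facts hold surely; chance then enters only through the signs. -/
theorem sampleArcs_support {S : Hyperarc V → Bool} {l : List (Hyperarc V)} (hl : l.Nodup)
    {z : Hyperarc V → ℝ≥0} {p : (List (Hyperarc V) × (Hyperarc V → ℝ≥0)) × ℕ}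
    (hp : p ∈ (sampleArcs S l z).law.support) :
    p.1.1.Sublist l ∧ (∀ f ∈ l, S f = true → f ∈ p.1.1) ∧
    (∀ f, p.1.2 f = if f ∈ p.1.1 ∧ S f = false then 2 * z f else z f) ∧
    p.2 ≤ 2 * l.length + 1 := by
  induction l generalizing z p with
  | nil =>
    rw [sampleArcs] at hp
    obtain ⟨r, hr, rfl⟩ := Comp.support_lift_bind hp
    obtain rfl := Comp.support_pure hr
    simp
  | cons f l ih =>
    obtain ⟨hfl, hl'⟩ := List.nodup_cons.1 hl
    by_cases hS : S f = true
    · rw [sampleArcs_cons_of_marked hS] at hp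
      obtain ⟨r, hr, rfl⟩ := Comp.support_lift_bind hp
      obtain ⟨s, hs, t, ht, rfl⟩ := Comp.support_bind hr
      obtain rfl := Comp.support_pure ht
      obtain ⟨h1, h2, h3, h4⟩ := ih hl' hs
      refine ⟨h1.cons_cons f, ?_, ?_, ?_⟩
      · intro g hg hgS
        rcases List.mem_cons.1 hg with rfl | hg
        · simp
        · simp [h2 g hg hgS]
      · intro g
        by_cases hgf : g = f
        · subst hgf; simp [h3, hS]
        · simp [h3, hgf]
      · simp; omega
    · rw [Bool.not_eq_true] at hS
      rw [sampleArcs_cons_of_not_marked hS] at hp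
      obtain ⟨r, hr, rfl⟩ := Comp.support_lift_bind hp
      obtain ⟨b, s, hs, rfl⟩ := Comp.support_coin_bind hr
      cases b with
      | true =>
        simp only [if_true] at hs
        obtain ⟨u, hu, t, ht, rfl⟩ := Comp.support_bind hs
        obtain rfl := Comp.support_pure ht
        obtain ⟨h1, h2, h3, h4⟩ := ih hl' hu
        refine ⟨h1.cons_cons f, ?_, ?_, ?_⟩
        · intro g hg hgS
          rcases List.mem_cons.1 hg with rfl | hg
          · simp
          · simp [h2 g hg hgS]
        · intro g
          by_cases hgf : g = f
          · subst hgf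
            have : g ∉ u.1.1 := fun h => hfl (h1.subset h)
            simp [h3, hS, this]
          · simp [h3, hgf]
        · simp; omega
      | false =>
        simp only [Bool.false_eq_true, if_false] at hs
        obtain ⟨h1, h2, h3, h4⟩ := ih hl' hs
        refine ⟨h1.cons f, ?_, h3, ?_⟩
        · intro g hg hgS
          rcases List.mem_cons.1 hg with rfl | hg
          · rw [hS] at hgS; simp at hgS
          · exact h2 g hg hgS
        · simp; omega

/-- The sign of a hyperarc with respect to a list: `1` if it is kept and `-1` if not. -/
def keepSign (R : List (Hyperarc V)) (f : Hyperarc V) : ℝ := if f ∈ R then 1 else -1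

/-- The unmarked hyperarcs of a list. -/
def unmarkedArcs (S : Hyperarc V → Bool) (l : List (Hyperarc V)) : Finset (Hyperarc V) :=
  l.toFinset.filter (fun f => S f = false)

theorem mem_unmarkedArcs {S : Hyperarc V → Bool} {l : List (Hyperarc V)} {f : Hyperarc V} :
    f ∈ unmarkedArcs S l ↔ f ∈ l ∧ S f = false := by
  simp [unmarkedArcs]

theorem unmarkedArcs_cons_of_marked {S : Hyperarc V → Bool} {f : Hyperarc V} (hf : S f = true)
    (l : List (Hyperarc V)) : unmarkedArcs S (f :: l) = unmarkedArcs S l := by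
  ext g
  simp only [mem_unmarkedArcs, List.mem_cons]
  constructor
  · rintro ⟨rfl | h, h'⟩
    · rw [hf] at h'; simp at h'
    · exact ⟨h, h'⟩
  · rintro ⟨h, h'⟩
    exact ⟨Or.inr h, h'⟩

theorem unmarkedArcs_cons_of_not_marked {S : Hyperarc V → Bool} {f : Hyperarc V}
    (hf : S f = false) (l : List (Hyperarc V)) :
    unmarkedArcs S (f :: l) = insert f (unmarkedArcs S l) := by
  ext g
  simp only [mem_unmarkedArcs, List.mem_cons, Finset.mem_insert]
  constructor
  · rintro ⟨rfl | h, h'⟩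
    · exact Or.inl rfl
    · exact Or.inr ⟨h, h'⟩
  · rintro (rfl | ⟨h, h'⟩)
    · exact ⟨Or.inl rfl, hf⟩
    · exact ⟨Or.inr h, h'⟩

theorem sum_keepSign_cons {S : Hyperarc V → Bool} {f : Hyperarc V} {l : List (Hyperarc V)}
    (hfl : f ∉ l) (θ : Hyperarc V → ℝ) (R : List (Hyperarc V)) :
    ∑ g ∈ unmarkedArcs S l, θ g * keepSign (f :: R) g =
      ∑ g ∈ unmarkedArcs S l, θ g * keepSign R g := by
  refine Finset.sum_congr rfl fun g hg => ?_
  have : g ≠ f := by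
    rintro rfl
    exact hfl (mem_unmarkedArcs.1 hg).1
  simp [keepSign, this]

/-- The exponential moments of the signed sums. -/
theorem sampleArcs_expect_exp_le {S : Hyperarc V → Bool} {l : List (Hyperarc V)} (hl : l.Nodup)
    (z : Hyperarc V → ℝ≥0) (θ : Hyperarc V → ℝ) :
    (sampleArcs S l z).law.expect (fun p => ENNReal.ofReal
      (Real.exp (∑ f ∈ unmarkedArcs S l, θ f * keepSign p.1.1 f))) ≤
    ENNReal.ofReal (Real.exp (∑ f ∈ unmarkedArcs S l, θ f ^ 2 / 2)) := by
  induction l generalizing z with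
  | nil =>
    have h : unmarkedArcs S ([] : List (Hyperarc V)) = ∅ := rfl
    simp only [h, Finset.sum_empty]
    rw [PMF.expect_const]
  | cons f l ih =>
    obtain ⟨hfl, hl'⟩ := List.nodup_cons.1 hl
    by_cases hS : S f = true
    · rw [sampleArcs_cons_of_marked hS, Comp.law_lift_bind, PMF.expect_map, Comp.law_bind,
        PMF.expect_bind, unmarkedArcs_cons_of_marked hS]
      simp only [PMF.expect_map, Comp.law_pure, PMF.expect_pure, sum_keepSign_cons hfl]
      exact ih hl' z
    · rw [Bool.not_eq_true] at hS
      have hfU : f ∉ unmarkedArcs S l := fun h => hfl (mem_unmarkedArcs.1 h).1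
      rw [sampleArcs_cons_of_not_marked hS, Comp.law_lift_bind, PMF.expect_map,
        Comp.law_coin_bind, unmarkedArcs_cons_of_not_marked hS]
      simp only [if_true, Bool.false_eq_true, if_false, Finset.sum_insert hfU]
      rw [Comp.law_bind, PMF.expect_bind]
      simp only [PMF.expect_map, Comp.law_pure, PMF.expect_pure, sum_keepSign_cons hfl]
      set B := ∑ f ∈ unmarkedArcs S l, θ f ^ 2 / 2 with hB
      -- Given the coin of `f`, the other signs obey the inductive bound, whatever the weights. The
      -- two outcomes together contribute the factor `cosh (θ f)`, which is at most `exp (θ f ^ 2 /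
      -- 2)`.
      have h1 : (sampleArcs S l (Function.update z f (2 * z f))).law.expect (fun p =>
          ENNReal.ofReal (Real.exp (θ f * keepSign (f :: p.1.1) f +
            ∑ g ∈ unmarkedArcs S l, θ g * keepSign p.1.1 g))) ≤
          ENNReal.ofReal (Real.exp (θ f)) * ENNReal.ofReal (Real.exp B) := by
        refine le_trans ?_ (mul_le_mul_right (ih hl' (Function.update z f (2 * z f))) _)
        rw [← PMF.expect_const_mul]
        refine PMF.expect_mono fun p _ => ?_
        rw [← ENNReal.ofReal_mul (Real.exp_pos _).le, ← Real.exp_add]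
        simp [keepSign]
      have h2 : (sampleArcs S l z).law.expect (fun p =>
          ENNReal.ofReal (Real.exp (θ f * keepSign p.1.1 f +
            ∑ g ∈ unmarkedArcs S l, θ g * keepSign p.1.1 g))) ≤
          ENNReal.ofReal (Real.exp (-θ f)) * ENNReal.ofReal (Real.exp B) := by
        refine le_trans ?_ (mul_le_mul_right (ih hl' z) _)
        rw [← PMF.expect_const_mul]
        refine PMF.expect_mono fun p hp => ?_
        rw [← ENNReal.ofReal_mul (Real.exp_pos _).le, ← Real.exp_add]
        have : f ∉ p.1.1 := fun h => hfl ((sampleArcs_support hl' hp).1.subset h)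
        simp [keepSign, this]
      refine (add_le_add (mul_le_mul_right h1 _) (mul_le_mul_right h2 _)).trans ?_
      have h3 : (2⁻¹ : ℝ≥0∞) = ENNReal.ofReal 2⁻¹ := by
        rw [ENNReal.ofReal_inv_of_pos (by norm_num)]; simp
      rw [h3, ← ENNReal.ofReal_mul (Real.exp_pos _).le, ← ENNReal.ofReal_mul (by norm_num),
        ← ENNReal.ofReal_mul (Real.exp_pos _).le, ← ENNReal.ofReal_mul (by norm_num),
        ← ENNReal.ofReal_add (by positivity) (by positivity)]
      refine ENNReal.ofReal_le_ofReal ?_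
      have h4 := Real.cosh_le_exp_half_sq (θ f)
      rw [Real.cosh_eq] at h4
      rw [Real.exp_add]
      nlinarith [Real.exp_pos B]

/-- A Hoeffding bound for the signed sums. -/
theorem sampleArcs_tail {S : Hyperarc V → Bool} {l : List (Hyperarc V)} (hl : l.Nodup)
    (z : Hyperarc V → ℝ≥0) (g : Hyperarc V → ℝ) {s v : ℝ} (hs : 0 ≤ s) (hv : 0 < v)
    (hg : ∑ f ∈ unmarkedArcs S l, g f ^ 2 ≤ v) :
    (sampleArcs S l z).law.toOuterMeasure
      {p | s < ∑ f ∈ unmarkedArcs S l, g f * keepSign p.1.1 f} ≤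
    ENNReal.ofReal (Real.exp (-(s ^ 2 / (2 * v)))) := by
  -- The multiplier `θ = s / v` minimises the Chernoff exponent `θ ^ 2 * v / 2 - θ * s`.
  have h1 := sampleArcs_expect_exp_le hl z (S := S) (fun f => s / v * g f)
  have h2 := (sampleArcs S l z).law.toOuterMeasure_mul_le_expect
    (E := {p | s < ∑ f ∈ unmarkedArcs S l, g f * keepSign p.1.1 f})
    (φ := fun p => ENNReal.ofReal
      (Real.exp (∑ f ∈ unmarkedArcs S l, (s / v * g f) * keepSign p.1.1 f)))
    (c := ENNReal.ofReal (Real.exp (s / v * s))) (by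
      intro p hp
      refine ENNReal.ofReal_le_ofReal (Real.exp_le_exp.2 ?_)
      simp only [mul_assoc, ← Finset.mul_sum]
      exact mul_le_mul_of_nonneg_left (le_of_lt hp) (by positivity))
  have h3 := h2.trans h1
  have h4 : Real.exp (∑ f ∈ unmarkedArcs S l, (s / v * g f) ^ 2 / 2) ≤
      Real.exp (s / v * s) * Real.exp (-(s ^ 2 / (2 * v))) := by
    rw [← Real.exp_add]
    refine Real.exp_le_exp.2 ?_
    simp only [mul_pow, ← Finset.sum_div, ← Finset.mul_sum]
    calc (s / v) ^ 2 * (∑ f ∈ unmarkedArcs S l, g f ^ 2) / 2 ≤ (s / v) ^ 2 * v / 2 := by gcongr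
      _ = s / v * s + -(s ^ 2 / (2 * v)) := by field_simp; ring
  have h5 := h3.trans (ENNReal.ofReal_le_ofReal h4)
  rw [ENNReal.ofReal_mul (Real.exp_pos _).le] at h5
  exact (ENNReal.mul_le_mul_iff_right (by simp [Real.exp_pos]) ENNReal.ofReal_ne_top).1 h5

end Sampling

/-! ### Chaining for maxima of weighted coordinates -/

section Chaining

variable {ι P : Type} [Fintype P]

/-- The maximum over `p` of `a f p * b p`. -/
def weightedMax (a : ι → P → ℝ≥0) (b : P → ℝ≥0) (f : ι) : ℝ≥0 :=
  Finset.univ.sup (fun p => a f p * b p)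

theorem weightedMax_le_iff {a : ι → P → ℝ≥0} {b : P → ℝ≥0} {f : ι} {r : ℝ≥0} :
    weightedMax a b f ≤ r ↔ ∀ p, a f p * b p ≤ r := by
  simp [weightedMax]

theorem le_weightedMax (a : ι → P → ℝ≥0) (b : P → ℝ≥0) (f : ι) (p : P) :
    a f p * b p ≤ weightedMax a b f :=
  weightedMax_le_iff.1 le_rfl p

theorem weightedMax_mono (a : ι → P → ℝ≥0) {b c : P → ℝ≥0} (h : ∀ p, b p ≤ c p) (f : ι) :
    weightedMax a b f ≤ weightedMax a c f :=
  weightedMax_le_iff.2 fun p => (mul_le_mul_right (h p) _).trans (le_weightedMax a c f p)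

/-- The part of `weightedMax` between the heights `t` and `T`. -/
def weightedLayer (a : ι → P → ℝ≥0) (t T : ℝ) (c : P → ℕ) (f : ι) : ℝ :=
  min (weightedMax a (fun p => (c p : ℝ≥0)) f : ℝ) T
    - min (weightedMax a (fun p => (c p : ℝ≥0)) f : ℝ) t

theorem weightedLayer_nonneg (a : ι → P → ℝ≥0) {t T : ℝ} (h : t ≤ T) (c : P → ℕ) (f : ι) :
    0 ≤ weightedLayer a t T c f :=
  sub_nonneg.2 (min_le_min_left _ h)

theorem weightedLayer_le_sub (a : ι → P → ℝ≥0) {t T : ℝ} (h : t ≤ T) (c : P → ℕ) (f : ι) :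
    weightedLayer a t T c f ≤ T - t := by
  unfold weightedLayer
  rcases le_total (weightedMax a (fun p => (c p : ℝ≥0)) f : ℝ) t with h1 | h1
  · rw [min_eq_left h1, min_eq_left (h1.trans h)]; linarith
  · rw [min_eq_right h1]; linarith [min_le_right (weightedMax a (fun p => (c p : ℝ≥0)) f : ℝ) T]

theorem weightedLayer_le_weightedMax (a : ι → P → ℝ≥0) {t T : ℝ} (ht : 0 ≤ t) (c : P → ℕ)
    (f : ι) : weightedLayer a t T c f ≤ weightedMax a (fun p => (c p : ℝ≥0)) f := by
  have h1 := min_le_left (weightedMax a (fun p => (c p : ℝ≥0)) f : ℝ) T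
  have h2 : 0 ≤ min (weightedMax a (fun p => (c p : ℝ≥0)) f : ℝ) t := le_min NNReal.zero_le_coe ht
  unfold weightedLayer
  linarith

/-- A layer depends only on the coordinates above its lower height. -/
theorem weightedLayer_restrict {a : ι → P → ℝ≥0} (ha : ∀ f p, a f p ≤ 1) {t T : ℝ}
    (ht : 0 ≤ t) (hT : t ≤ T) (c : P → ℕ) (f : ι) :
    weightedLayer a t T (fun p => if t < (c p : ℝ) then c p else 0) f
      = weightedLayer a t T c f := by
  unfold weightedLayer
  set c' : P → ℕ := fun p => if t < (c p : ℝ) then c p else 0 with hc'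
  have hle : weightedMax a (fun p => (c' p : ℝ≥0)) f ≤ weightedMax a (fun p => (c p : ℝ≥0)) f := by
    refine weightedMax_mono a (fun p => ?_) f
    simp only [hc']
    split_ifs <;> simp
  rcases le_or_gt (weightedMax a (fun p => (c p : ℝ≥0)) f : ℝ) t with h1 | h1
  · have h2 : (weightedMax a (fun p => (c' p : ℝ≥0)) f : ℝ) ≤ t := le_trans (by exact_mod_cast hle) h1
    rw [min_eq_left h1, min_eq_left (h1.trans hT), min_eq_left h2, min_eq_left (h2.trans hT)]
    simp
  -- Since `a ≤ 1`, a product above `t` comes from a coordinate above `t`, which is kept. The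
  -- maximum exceeds `t`, so the dropped coordinates, whose products are at most `t`, do not affect
  -- it.
  · have key : ∀ p, t < (a f p * (c p : ℝ≥0) : ℝ≥0) → c' p = c p := by
      intro p hp
      have : (a f p * (c p : ℝ≥0) : ℝ≥0) ≤ (c p : ℝ≥0) := mul_le_of_le_one_left' (ha f p)
      have h3 : t < (c p : ℝ) := hp.trans_le (by exact_mod_cast this)
      simp [hc', h3]
    obtain ⟨p, hp⟩ : ∃ p, t < (a f p * (c p : ℝ≥0) : ℝ≥0) := by
      by_contra hcon
      push Not at hcon
      have : weightedMax a (fun p => (c p : ℝ≥0)) f ≤ ⟨t, ht⟩ := weightedMax_le_iff.2 hcon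
      exact absurd (show (weightedMax a (fun p => (c p : ℝ≥0)) f : ℝ) ≤ t from this) (not_le.2 h1)
    have heq : weightedMax a (fun p => (c' p : ℝ≥0)) f = weightedMax a (fun p => (c p : ℝ≥0)) f := by
      refine le_antisymm hle (weightedMax_le_iff.2 fun q => ?_)
      rcases le_or_gt ((a f q * (c q : ℝ≥0) : ℝ≥0) : ℝ) t with h2 | h2
      · have h3 := le_weightedMax a (fun p => (c' p : ℝ≥0)) f p
        rw [key p hp] at h3
        have h4 : (a f q * (c q : ℝ≥0) : ℝ≥0) ≤ a f p * (c p : ℝ≥0) := by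
          exact_mod_cast h2.trans hp.le
        exact h4.trans h3
      · have h3 := le_weightedMax a (fun p => (c' p : ℝ≥0)) f q
        rwa [key q h2] at h3
    rw [heq]

/-- Markov's inequality for the counting measure. At `t = D / 2 ^ (k + 1)` it leaves at most `2 ^ (k
+ 1)` coordinates for layer `k`. -/
theorem card_filter_lt_mul_le (c : P → ℕ) {t D : ℝ} (h : ∑ p, (c p : ℝ) ≤ D) :
    ((Finset.univ.filter (fun p => t < (c p : ℝ))).card : ℝ) * t ≤ D := by
  calc ((Finset.univ.filter (fun p => t < (c p : ℝ))).card : ℝ) * t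
      = ∑ p ∈ Finset.univ.filter (fun p => t < (c p : ℝ)), t := by simp
    _ ≤ ∑ p ∈ Finset.univ.filter (fun p => t < (c p : ℝ)), (c p : ℝ) :=
        Finset.sum_le_sum fun p hp => (Finset.mem_filter.1 hp).2.le
    _ ≤ ∑ p, (c p : ℝ) :=
        Finset.sum_le_sum_of_subset_of_nonneg (Finset.filter_subset _ _) (fun _ _ _ => by positivity)
    _ ≤ D := h

theorem abs_sum_sign_mul_le {U : Finset ι} {σ : ι → ℝ} (hσ : ∀ f ∈ U, |σ f| ≤ 1) {y : ι → ℝ}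
    {B : ℝ} (hy : ∀ f ∈ U, |y f| ≤ B) : |∑ f ∈ U, y f * σ f| ≤ U.card * B := by
  calc |∑ f ∈ U, y f * σ f| ≤ ∑ f ∈ U, |y f * σ f| := Finset.abs_sum_le_sum_abs _ _
    _ ≤ ∑ f ∈ U, B := Finset.sum_le_sum fun f hf => by
        rw [abs_mul]
        nlinarith [hσ f hf, hy f hf, abs_nonneg (y f), abs_nonneg (σ f)]
    _ = U.card * B := by simp

/-- Discretisation and chaining: bounds for the signed sums of the layers of sparse integer
vectors give a bound for the signed sums of all the functions `weightedMax a b`. -/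
theorem abs_sum_weightedMax_le {a : ι → P → ℝ≥0} (ha : ∀ f p, a f p ≤ 1) {U : Finset ι}
    {σ : ι → ℝ} (hσ : ∀ f ∈ U, |σ f| ≤ 1) {D M τ : ℝ} (hD : 0 < D) (J : ℕ)
    (hlayer : ∀ k < J, ∀ c : P → ℕ, (∀ p, c p ≤ ⌊D⌋₊) →
      (Finset.univ.filter (fun p => c p ≠ 0)).card ≤ 2 ^ (k + 1) →
      ∑ f ∈ U, weightedLayer a (D / 2 ^ (k + 1)) (D / 2 ^ k) c f ≤ M →
      |∑ f ∈ U, weightedLayer a (D / 2 ^ (k + 1)) (D / 2 ^ k) c f * σ f| ≤ τ)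
    {u : ℝ≥0} (hu : 0 < u) {b : P → ℝ≥0} (hb : ∑ p, (b p : ℝ) ≤ u * D)
    (hbM : ∑ f ∈ U, (weightedMax a b f : ℝ) ≤ u * M) :
    |∑ f ∈ U, (weightedMax a b f : ℝ) * σ f| ≤ u * (J * τ + U.card * (D / 2 ^ J) + U.card) := by
  have hu' : (0 : ℝ) < u := by exact_mod_cast hu
  -- Rounding down to multiples of `u` lowers every maximum by at most `u`, because `a ≤ 1`.
  set c : P → ℕ := fun p => ⌊b p / u⌋₊ with hc
  set e : ι → ℝ := fun f => (weightedMax a (fun p => (c p : ℝ≥0)) f : ℝ) with he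
  have hc1 : ∀ p, u * (c p : ℝ≥0) ≤ b p := fun p => by
    have := Nat.floor_le (zero_le (a := b p / u))
    rw [mul_comm]
    exact (le_div_iff₀ hu).1 this
  have hc2 : ∀ p, b p ≤ u * (c p : ℝ≥0) + u := fun p => by
    have := (Nat.lt_floor_add_one (b p / u)).le
    rw [div_le_iff₀ hu] at this
    calc b p ≤ _ := this
      _ = u * (c p : ℝ≥0) + u := by simp only [hc]; ring
  have he1 : ∀ f, (u : ℝ) * e f ≤ weightedMax a b f := by
    intro f
    have : weightedMax a (fun p => (c p : ℝ≥0)) f ≤ weightedMax a b f / u := by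
      refine weightedMax_le_iff.2 fun p => ?_
      rw [le_div_iff₀ hu]
      calc a f p * (c p : ℝ≥0) * u = a f p * (u * (c p : ℝ≥0)) := by ring
        _ ≤ a f p * b p := mul_le_mul_right (hc1 p) _
        _ ≤ _ := le_weightedMax a b f p
    rw [le_div_iff₀ hu] at this
    rw [mul_comm]
    exact_mod_cast this
  have he2 : ∀ f, (weightedMax a b f : ℝ) ≤ u * e f + u := by
    intro f
    have : weightedMax a b f ≤ u * weightedMax a (fun p => (c p : ℝ≥0)) f + u := by
      refine weightedMax_le_iff.2 fun p => ?_
      calc a f p * b p ≤ a f p * (u * (c p : ℝ≥0) + u) := mul_le_mul_right (hc2 p) _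
        _ = u * (a f p * (c p : ℝ≥0)) + a f p * u := by ring
        _ ≤ u * weightedMax a (fun p => (c p : ℝ≥0)) f + u := by
          refine add_le_add (mul_le_mul_right ?_ _) (mul_le_of_le_one_left' (ha f p))
          exact le_weightedMax a (fun p => (c p : ℝ≥0)) f p
    exact_mod_cast this
  have hsc : ∑ p, (c p : ℝ) ≤ D := by
    have h1 : (u : ℝ) * ∑ p, (c p : ℝ) ≤ ∑ p, (b p : ℝ) := by
      rw [Finset.mul_sum]
      exact Finset.sum_le_sum fun p _ => by exact_mod_cast hc1 p
    exact le_of_mul_le_mul_left (h1.trans hb) hu'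
  have hse : ∑ f ∈ U, e f ≤ M := by
    have h1 : (u : ℝ) * ∑ f ∈ U, e f ≤ ∑ f ∈ U, (weightedMax a b f : ℝ) := by
      rw [Finset.mul_sum]
      exact Finset.sum_le_sum fun f _ => he1 f
    exact le_of_mul_le_mul_left (h1.trans hbM) hu'
  have hcD : ∀ p, (c p : ℝ) ≤ D := fun p =>
    (Finset.single_le_sum (f := fun p => (c p : ℝ)) (fun _ _ => by positivity)
      (Finset.mem_univ p)).trans hsc
  have heD : ∀ f, e f ≤ D := by
    intro f
    have : weightedMax a (fun p => (c p : ℝ≥0)) f ≤ ⟨D, hD.le⟩ := by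
      refine weightedMax_le_iff.2 fun p => (mul_le_of_le_one_left' (ha f p)).trans ?_
      exact hcD p
    exact this
  -- The layers telescope from the height `D`, which no value exceeds, down to `D / 2 ^ J`; the part
  -- below is bounded trivially.
  have htel : ∀ f, e f = (∑ k ∈ Finset.range J,
      weightedLayer a (D / 2 ^ (k + 1)) (D / 2 ^ k) c f) + min (e f) (D / 2 ^ J) := by
    intro f
    have h1 := Finset.sum_range_sub' (fun k => min (e f) (D / 2 ^ k)) J
    have h2 : (∑ k ∈ Finset.range J, weightedLayer a (D / 2 ^ (k + 1)) (D / 2 ^ k) c f)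
        = min (e f) (D / 2 ^ 0) - min (e f) (D / 2 ^ J) := h1
    rw [h2, pow_zero, div_one, min_eq_left (heD f)]
    ring
  have hlay : ∀ k ∈ Finset.range J,
      |∑ f ∈ U, weightedLayer a (D / 2 ^ (k + 1)) (D / 2 ^ k) c f * σ f| ≤ τ := by
    intro k hk
    have ht : 0 < D / 2 ^ (k + 1) := by positivity
    have hT : D / 2 ^ (k + 1) ≤ D / 2 ^ k := by
      gcongr
      · norm_num
      · omega
    simp only [← weightedLayer_restrict ha ht.le hT c]
    refine hlayer k (Finset.mem_range.1 hk) _ (fun p => ?_) ?_ ?_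
    · split_ifs
      · exact Nat.le_floor (hcD p)
      · exact zero_le
    · have h1 := card_filter_lt_mul_le c (t := D / 2 ^ (k + 1)) hsc
      have h2 : (Finset.univ.filter (fun p => D / 2 ^ (k + 1) < (c p : ℝ))).card ≤ 2 ^ (k + 1) := by
        rw [mul_div_assoc', div_le_iff₀ (by positivity), mul_comm] at h1
        have := le_of_mul_le_mul_left h1 hD
        exact_mod_cast this
      refine (Finset.card_le_card fun p hp => ?_).trans h2
      simp only [Finset.mem_filter, Finset.mem_univ, true_and, ne_eq, ite_eq_right_iff,
        Classical.not_imp] at hp ⊢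
      exact hp.1
    · refine (Finset.sum_le_sum fun f _ => ?_).trans hse
      rw [weightedLayer_restrict ha ht.le hT c]
      exact weightedLayer_le_weightedMax a ht.le c f
  have hsum : |∑ f ∈ U, e f * σ f| ≤ J * τ + U.card * (D / 2 ^ J) := by
    have h1 : ∑ f ∈ U, e f * σ f = (∑ k ∈ Finset.range J,
        ∑ f ∈ U, weightedLayer a (D / 2 ^ (k + 1)) (D / 2 ^ k) c f * σ f) +
        ∑ f ∈ U, min (e f) (D / 2 ^ J) * σ f := by
      rw [Finset.sum_comm, ← Finset.sum_add_distrib]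
      refine Finset.sum_congr rfl fun f _ => ?_
      rw [← Finset.sum_mul, ← add_mul, ← htel f]
    rw [h1]
    refine (abs_add_le _ _).trans (add_le_add ?_ ?_)
    · refine (Finset.abs_sum_le_sum_abs _ _).trans ((Finset.sum_le_sum hlay).trans ?_)
      simp
    · refine abs_sum_sign_mul_le hσ fun f _ => ?_
      rw [abs_of_nonneg (le_min NNReal.zero_le_coe (by positivity))]
      exact min_le_right _ _
  have hround : |∑ f ∈ U, ((weightedMax a b f : ℝ) - u * e f) * σ f| ≤ U.card * u := by
    refine abs_sum_sign_mul_le hσ fun f _ => ?_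
    rw [abs_of_nonneg (by linarith [he1 f])]
    linarith [he2 f]
  have hdecomp : ∑ f ∈ U, (weightedMax a b f : ℝ) * σ f =
      u * ∑ f ∈ U, e f * σ f + ∑ f ∈ U, ((weightedMax a b f : ℝ) - u * e f) * σ f := by
    rw [Finset.mul_sum, ← Finset.sum_add_distrib]
    exact Finset.sum_congr rfl fun f _ => by ring
  rw [hdecomp]
  refine (abs_add_le _ _).trans ?_
  rw [abs_mul, abs_of_pos hu']
  nlinarith [mul_le_mul_of_nonneg_left hsum hu'.le]

/-- The functions with at most `r` non-zero values, all of them at most `d`. -/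
def sparseFunctions (P : Type) [Fintype P] [DecidableEq P] (d : ℕ) : ℕ → Finset (P → ℕ)
  | 0 => {0}
  | r + 1 => (sparseFunctions P d r ×ˢ (Finset.univ ×ˢ Finset.range (d + 1))).image
      (fun q => Function.update q.1 q.2.1 q.2.2)

theorem card_sparseFunctions_le [DecidableEq P] (d r : ℕ) :
    (sparseFunctions P d r).card ≤ (Fintype.card P * (d + 1)) ^ r := by
  induction r with
  | zero => simp [sparseFunctions]
  | succ r ih =>
    refine Finset.card_image_le.trans ?_
    rw [Finset.card_product, Finset.card_product, Finset.card_univ, Finset.card_range, pow_succ]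
    exact Nat.mul_le_mul_right _ ih

theorem mem_sparseFunctions [DecidableEq P] [Nonempty P] {d r : ℕ} {c : P → ℕ}
    (hd : ∀ p, c p ≤ d) (hr : (Finset.univ.filter (fun p => c p ≠ 0)).card ≤ r) :
    c ∈ sparseFunctions P d r := by
  induction r generalizing c with
  | zero =>
    have h : ∀ p, c p = 0 := by simpa [Finset.filter_eq_empty_iff] using hr
    simp only [sparseFunctions, Finset.mem_singleton]
    exact funext h
  | succ r ih =>
    obtain ⟨p, hp⟩ : ∃ p, (Finset.univ.filter (fun q => Function.update c p 0 q ≠ 0)).card ≤ r := by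
      by_cases h : ∃ p, c p ≠ 0
      · obtain ⟨p, hp⟩ := h
        refine ⟨p, Nat.lt_succ_iff.1 (lt_of_lt_of_le (Finset.card_lt_card ?_) hr)⟩
        rw [Finset.ssubset_iff_of_subset]
        · exact ⟨p, by simp [hp], by simp⟩
        · intro q hq
          by_cases hqp : q = p
          · subst hqp; simp at hq
          · simpa [hqp] using hq
      · push Not at h
        -- There is no non-zero coordinate to erase, and overwriting any coordinate by `0` changes
        -- nothing.
        refine ⟨Classical.arbitrary P, ?_⟩
        have : c = 0 := funext h
        simp [this]
    refine Finset.mem_image.2 ⟨(Function.update c p 0, p, c p), ?_, by simp⟩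
    simp only [Finset.mem_product, Finset.mem_univ, true_and, Finset.mem_range]
    refine ⟨ih (fun q => ?_) hp, Nat.lt_succ_of_le (hd p)⟩
    by_cases hqp : q = p
    · subst hqp; simp
    · simpa [hqp] using hd q

end Chaining

/-! ### One round: deterministic estimates -/

section Energy

variable {V : Type}

theorem DirHypergraph.arcEnergy_nonneg (H : DirHypergraph V) (x : V → ℝ) (f : Hyperarc V) :
    0 ≤ H.arcEnergy x f := by
  obtain ⟨p, hp⟩ := f.biclique_nonempty
  refine mul_nonneg NNReal.zero_le_coe (le_trans (sq_nonneg (max (x p.1 - x p.2) 0)) ?_)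
  exact Finset.le_sup' (fun p : V × V => (max (x p.1 - x p.2) 0) ^ 2) hp

theorem DirHypergraph.energy_nonneg (H : DirHypergraph V) (x : V → ℝ) : 0 ≤ H.energy x :=
  Finset.sum_nonneg fun f _ => H.arcEnergy_nonneg x f

end Energy

section OneStep

variable {V : Type} [LinearOrder V]

/-- `(R, w)` is a possible outcome of sampling the unmarked hyperarcs of `(L, z)`. -/
structure IsSample (S : Hyperarc V → Bool) (L : List (Hyperarc V)) (z : Hyperarc V → ℝ≥0)
    (R : List (Hyperarc V)) (w : Hyperarc V → ℝ≥0) : Prop where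
  sublist : R.Sublist L
  marked_mem : ∀ f ∈ L, S f = true → f ∈ R
  weight_eq : ∀ f, w f = if f ∈ R ∧ S f = false then 2 * z f else z f

theorem card_unmarkedArcs_le {S : Hyperarc V → Bool} {L : List (Hyperarc V)} (hL : L.Nodup) :
    (unmarkedArcs S L).card ≤ L.length := by
  rw [← List.toFinset_card_of_nodup hL]
  exact Finset.card_filter_le _ _

theorem abs_keepSign_le (R : List (Hyperarc V)) (f : Hyperarc V) : |keepSign R f| ≤ 1 := by
  unfold keepSign; split_ifs <;> simp

section Sample

variable {S : Hyperarc V → Bool} {L R : List (Hyperarc V)} {z w : Hyperarc V → ℝ≥0}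

/-- An unmarked hyperarc is doubled or lost, so its energy changes by plus or minus its old value;
marked ones do not change. -/
theorem IsSample.energy_sub (h : IsSample S L z R w) (x : V → ℝ) :
    (toHypergraph (R, w)).energy x - (toHypergraph (L, z)).energy x =
      ∑ f ∈ unmarkedArcs S L, (toHypergraph (L, z)).arcEnergy x f * keepSign R f := by
  have h1 : (toHypergraph (R, w)).energy x = ∑ f ∈ L.toFinset,
      if f ∈ R then (toHypergraph (R, w)).arcEnergy x f else 0 := by
    rw [← Finset.sum_filter]
    refine Finset.sum_congr ?_ fun _ _ => rfl
    ext f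
    simp only [toHypergraph, List.mem_toFinset, Finset.mem_filter]
    exact ⟨fun hf => ⟨h.sublist.subset hf, hf⟩, fun hf => hf.2⟩
  have h2 : (toHypergraph (L, z)).energy x
      = ∑ f ∈ L.toFinset, (toHypergraph (L, z)).arcEnergy x f := rfl
  rw [h1, h2, ← Finset.sum_sub_distrib, unmarkedArcs, Finset.sum_filter]
  refine Finset.sum_congr rfl fun f hf => ?_
  have hw := h.weight_eq f
  by_cases hS : S f = true
  · have hR := h.marked_mem f (List.mem_toFinset.1 hf) hS
    simp only [hS, Bool.true_eq_false, and_false, if_false] at hw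
    simp [hR, hS, DirHypergraph.arcEnergy, toHypergraph, hw]
  · rw [Bool.not_eq_true] at hS
    by_cases hR : f ∈ R
    · simp only [hS, hR, and_true, if_true] at hw
      simp only [hR, hS, DirHypergraph.arcEnergy, toHypergraph, hw, keepSign, if_true]
      push_cast
      ring
    · simp [hR, hS, keepSign]

/-- On unmarked hyperarcs the indicator of being kept is `(1 + keepSign) / 2`; on marked ones it is
`1`. Thus the size is controlled by the signed sum with all coefficients `1`. -/
theorem IsSample.two_mul_length (h : IsSample S L z R w) (hL : L.Nodup) :
    2 * (R.length : ℝ) = 2 * ((L.toFinset.filter (fun f => S f = true)).card : ℝ) +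
      (unmarkedArcs S L).card + ∑ f ∈ unmarkedArcs S L, keepSign R f := by
  have h1 : (R.length : ℝ) = ∑ f ∈ L.toFinset, if f ∈ R then (1 : ℝ) else 0 := by
    rw [← Finset.sum_filter, Finset.sum_const, nsmul_eq_mul, mul_one,
      ← List.toFinset_card_of_nodup (h.sublist.nodup hL)]
    congr 2
    ext f
    simp only [List.mem_toFinset, Finset.mem_filter]
    exact ⟨fun hf => ⟨h.sublist.subset hf, hf⟩, fun hf => hf.2⟩
  have h2 : ∀ s : Finset (Hyperarc V), (s.card : ℝ) = ∑ f ∈ s, (1 : ℝ) := by simp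
  rw [h1, h2, h2, Finset.mul_sum, Finset.mul_sum, add_assoc, ← Finset.sum_add_distrib, unmarkedArcs,
    Finset.sum_filter, Finset.sum_filter, ← Finset.sum_add_distrib]
  refine Finset.sum_congr rfl fun f hf => ?_
  by_cases hS : S f = true
  · have hR := h.marked_mem f (List.mem_toFinset.1 hf) hS
    simp [hS, hR]
  · rw [Bool.not_eq_true] at hS
    by_cases hR : f ∈ R
    · simp [hS, hR, keepSign]; norm_num
    · simp [hS, hR, keepSign]

end Sample

section CoresetWeights

/-- The largest weight of an unmarked hyperarc whose biclique contains `p`. -/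
def pairWeight (S : Hyperarc V → Bool) (L : List (Hyperarc V)) (z : Hyperarc V → ℝ≥0)
    (p : V × V) : ℝ≥0 :=
  ((unmarkedArcs S L).filter (fun f => p ∈ f.biclique)).sup z

/-- The weight of an unmarked hyperarc relative to the weight of a pair in its biclique. -/
def relativeWeight (S : Hyperarc V → Bool) (L : List (Hyperarc V)) (z : Hyperarc V → ℝ≥0)
    (f : Hyperarc V) (p : V × V) : ℝ≥0 :=
  if f ∈ unmarkedArcs S L ∧ p ∈ f.biclique then z f / pairWeight S L z p else 0

/-- The energy of a pair. -/
def pairEnergy (S : Hyperarc V → Bool) (L : List (Hyperarc V)) (z : Hyperarc V → ℝ≥0)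
    (x : V → ℝ) (p : V × V) : ℝ≥0 :=
  pairWeight S L z p * Real.toNNReal (x p.1 - x p.2) ^ 2

variable {S : Hyperarc V → Bool} {L : List (Hyperarc V)} {z : Hyperarc V → ℝ≥0}

theorem le_pairWeight {f : Hyperarc V} (hf : f ∈ unmarkedArcs S L) {p : V × V}
    (hp : p ∈ f.biclique) : z f ≤ pairWeight S L z p :=
  Finset.le_sup (f := z) (Finset.mem_filter.2 ⟨hf, hp⟩)

theorem relativeWeight_le_one (f : Hyperarc V) (p : V × V) : relativeWeight S L z f p ≤ 1 := by
  unfold relativeWeight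
  split_ifs with h
  · exact div_le_one_of_le₀ (le_pairWeight h.1 h.2) zero_le
  · exact zero_le

theorem relativeWeight_mul_pairEnergy {f : Hyperarc V} (hf : f ∈ unmarkedArcs S L) {p : V × V}
    (hp : p ∈ f.biclique) (x : V → ℝ) :
    ((relativeWeight S L z f p * pairEnergy S L z x p : ℝ≥0) : ℝ) =
      z f * (max (x p.1 - x p.2) 0) ^ 2 := by
  have h1 : z f / pairWeight S L z p * pairWeight S L z p = z f := by
    -- A vanishing pair weight makes the quotient `0` by convention, but then `z f = 0` as well.
    by_cases h : pairWeight S L z p = 0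
    · have := le_pairWeight (z := z) hf hp
      rw [h] at this
      simp [h, le_antisymm this zero_le]
    · exact div_mul_cancel₀ _ h
  rw [relativeWeight, if_pos ⟨hf, hp⟩, pairEnergy, ← mul_assoc, h1]
  push_cast
  rw [Real.coe_toNNReal']

/-- This separates `f` from `x`: the coefficients are at most `1` and free of `x`, so the energies
fall under the chaining bound, with `pairEnergy` as the only varying vector. -/
theorem weightedMax_pairEnergy [Fintype V] {f : Hyperarc V} (hf : f ∈ unmarkedArcs S L)
    (x : V → ℝ) :
    (weightedMax (relativeWeight S L z) (pairEnergy S L z x) f : ℝ) =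
      (toHypergraph (L, z)).arcEnergy x f := by
  refine le_antisymm ?_ ?_
  · have : weightedMax (relativeWeight S L z) (pairEnergy S L z x) f ≤
        Real.toNNReal ((toHypergraph (L, z)).arcEnergy x f) := by
      refine weightedMax_le_iff.2 fun p => ?_
      by_cases hp : p ∈ f.biclique
      · rw [← NNReal.coe_le_coe, relativeWeight_mul_pairEnergy hf hp,
          Real.coe_toNNReal _ (DirHypergraph.arcEnergy_nonneg _ x f)]
        exact mul_le_mul_of_nonneg_left
          (Finset.le_sup' (fun p : V × V => (max (x p.1 - x p.2) 0) ^ 2) hp) NNReal.zero_le_coe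
      · simp [relativeWeight, hp]
    rwa [← NNReal.coe_le_coe, Real.coe_toNNReal _ (DirHypergraph.arcEnergy_nonneg _ x f)] at this
  · obtain ⟨p, hp, h⟩ := Finset.exists_mem_eq_sup' f.biclique_nonempty
      (fun p : V × V => (max (x p.1 - x p.2) 0) ^ 2)
    rw [DirHypergraph.arcEnergy, h]
    have := le_weightedMax (relativeWeight S L z) (pairEnergy S L z x) f p
    rw [← NNReal.coe_le_coe, relativeWeight_mul_pairEnergy hf hp] at this
    exact this

/-- If some unmarked hyperarc covers `p`, then `D p` has exactly `lam` members, each at least as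
heavy as every unmarked hyperarc at `p` and with `p` in its biclique, hence of energy at least that
of `p`. The sets `D p` are disjoint, so no energy is counted twice. -/
theorem IsCoreset.sum_pairEnergy_le [Fintype V] {lam : ℕ} {D : V × V → Finset (Hyperarc V)}
    (h : IsCoreset L z lam S D) (x : V → ℝ) :
    lam * ∑ p, (pairEnergy S L z x p : ℝ) ≤ (toHypergraph (L, z)).energy x := by
  have h1 : ∀ p, lam * (pairEnergy S L z x p : ℝ) ≤
      ∑ g ∈ D p, (toHypergraph (L, z)).arcEnergy x g := by
    intro p
    rcases ((unmarkedArcs S L).filter (fun f => p ∈ f.biclique)).eq_empty_or_nonempty with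
      he | ⟨f, hf⟩
    · have : pairWeight S L z p = 0 := by rw [pairWeight, he]; rfl
      simp only [pairEnergy, this, zero_mul, NNReal.coe_zero, mul_zero]
      exact Finset.sum_nonneg fun g _ => DirHypergraph.arcEnergy_nonneg _ x g
    · obtain ⟨hfU, hfp⟩ := Finset.mem_filter.1 hf
      obtain ⟨hfL, hfS⟩ := mem_unmarkedArcs.1 hfU
      rw [← h.card_eq f hfL hfS p hfp, ← nsmul_eq_mul]
      refine Finset.card_nsmul_le_sum _ _ _ fun g hg => ?_
      have hw : pairWeight S L z p ≤ z g := by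
        refine Finset.sup_le fun f' hf' => ?_
        obtain ⟨hfU', hfp'⟩ := Finset.mem_filter.1 hf'
        obtain ⟨hfL', hfS'⟩ := mem_unmarkedArcs.1 hfU'
        exact h.weight_le f' hfL' hfS' p hfp' g hg
      simp only [pairEnergy, NNReal.coe_mul, NNReal.coe_pow, Real.coe_toNNReal']
      refine mul_le_mul hw ?_ (sq_nonneg _) NNReal.zero_le_coe
      exact Finset.le_sup' (fun p : V × V => (max (x p.1 - x p.2) 0) ^ 2) (h.mem p g hg).2
  rw [Finset.mul_sum]
  refine (Finset.sum_le_sum fun p _ => h1 p).trans ?_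
  rw [← Finset.sum_biUnion (fun p _ p' _ hpp => h.disjoint p p' hpp)]
  refine Finset.sum_le_sum_of_subset_of_nonneg (fun f hf => ?_)
    (fun f _ _ => DirHypergraph.arcEnergy_nonneg _ x f)
  obtain ⟨p, -, hp⟩ := Finset.mem_biUnion.1 hf
  exact List.mem_toFinset.2 (h.mem p f hp).1

end CoresetWeights

/-- The outcome of one step is an `ε`-approximation with at most three quarters of the
hyperarcs. -/
structure IsGoodStep (ε : ℝ) (L : List (Hyperarc V)) (z : Hyperarc V → ℝ≥0)
    (p : (List (Hyperarc V) × (Hyperarc V → ℝ≥0))) : Prop where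
  energy : ∀ x, |(toHypergraph p).energy x - (toHypergraph (L, z)).energy x| ≤
    ε * (toHypergraph (L, z)).energy x
  length : (p.1.length : ℝ) ≤ 3 / 4 * L.length

section Deterministic

variable [Fintype V] {S : Hyperarc V → Bool} {L R : List (Hyperarc V)} {z w : Hyperarc V → ℝ≥0}
  {lam : ℕ} {D : V × V → Finset (Hyperarc V)}

/-- With `m = L.length` and the unit `u = Q ε / (4m)`, the `J` layers contribute `2m`, the part
below height `D / 2 ^ J ≤ 1` contributes `m`, and rounding contributes `m`: together `4m u = ε Q`.
Twice the number of hyperarcs kept is at most `2 · m/8 + m + m/4 = 3m/2`. -/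
theorem IsSample.isGoodStep (h : IsSample S L z R w) (hL : L.Nodup)
    (hD : IsCoreset L z lam S D) {ε : ℝ} (hε : 0 < ε) (hlam : 0 < lam) (hLpos : 0 < L.length)
    {J : ℕ} (hJ : 0 < J) (hJ' : 4 * (L.length : ℝ) / (ε * lam) ≤ 2 ^ J)
    (hS : (Fintype.card V : ℝ) ^ 2 * lam ≤ L.length / 8)
    (hsum : ∑ f ∈ unmarkedArcs S L, keepSign R f ≤ (L.length : ℝ) / 4)
    (hlayer : ∀ k < J, ∀ c : V × V → ℕ, (∀ p, c p ≤ ⌊4 * (L.length : ℝ) / (ε * lam)⌋₊) →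
      (Finset.univ.filter (fun p => c p ≠ 0)).card ≤ 2 ^ (k + 1) →
      ∑ f ∈ unmarkedArcs S L, weightedLayer (relativeWeight S L z)
        (4 * (L.length : ℝ) / (ε * lam) / 2 ^ (k + 1)) (4 * (L.length : ℝ) / (ε * lam) / 2 ^ k)
        c f ≤ 4 * (L.length : ℝ) / ε →
      |∑ f ∈ unmarkedArcs S L, weightedLayer (relativeWeight S L z)
        (4 * (L.length : ℝ) / (ε * lam) / 2 ^ (k + 1)) (4 * (L.length : ℝ) / (ε * lam) / 2 ^ k)
        c f * keepSign R f| ≤ 2 * (L.length : ℝ) / J) :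
    IsGoodStep ε L z (R, w) := by
  have hm : (0 : ℝ) < L.length := by exact_mod_cast hLpos
  have hl : (0 : ℝ) < lam := by exact_mod_cast hlam
  have hJr : (0 : ℝ) < J := by exact_mod_cast hJ
  have hU : ((unmarkedArcs S L).card : ℝ) ≤ L.length := by exact_mod_cast card_unmarkedArcs_le hL
  constructor
  · intro x
    rw [h.energy_sub x]
    set Q := (toHypergraph (L, z)).energy x with hQ
    have hUQ : ∑ f ∈ unmarkedArcs S L, (toHypergraph (L, z)).arcEnergy x f ≤ Q :=
      Finset.sum_le_sum_of_subset_of_nonneg (Finset.filter_subset _ _)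
        (fun f _ _ => DirHypergraph.arcEnergy_nonneg _ x f)
    -- The unit of rounding is proportional to `Q`, so `Q = 0` needs a separate treatment; there all
    -- energies vanish.
    rcases (DirHypergraph.energy_nonneg (toHypergraph (L, z)) x).eq_or_lt' with h0 | hpos
    · rw [← hQ] at h0
      have hz : ∀ f ∈ unmarkedArcs S L, (toHypergraph (L, z)).arcEnergy x f = 0 := by
        refine (Finset.sum_eq_zero_iff_of_nonneg
          (fun f _ => DirHypergraph.arcEnergy_nonneg _ x f)).1 (le_antisymm (hUQ.trans h0.le) ?_)
        exact Finset.sum_nonneg fun f _ => DirHypergraph.arcEnergy_nonneg _ x f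
      rw [Finset.sum_eq_zero fun f hf => by rw [hz f hf, zero_mul], h0]
      simp
    · rw [← hQ] at hpos
      have hu : 0 < Q * ε / (4 * L.length) := by positivity
      have hb := hD.sum_pairEnergy_le x
      have key := abs_sum_weightedMax_le (relativeWeight_le_one (S := S) (L := L) (z := z))
        (U := unmarkedArcs S L) (σ := keepSign R) (fun f _ => abs_keepSign_le R f)
        (by positivity) J hlayer (u := Real.toNNReal (Q * ε / (4 * L.length))) (Real.toNNReal_pos.2 hu)
        (b := pairEnergy S L z x)
        (by
          rw [Real.coe_toNNReal _ hu.le]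
          have : Q * ε / (4 * L.length) * (4 * (L.length : ℝ) / (ε * lam)) = Q / lam := by
            field_simp
          rw [this, le_div_iff₀ hl, mul_comm]
          exact hb)
        (by
          rw [Real.coe_toNNReal _ hu.le]
          have : Q * ε / (4 * L.length) * (4 * (L.length : ℝ) / ε) = Q := by
            field_simp
          rw [this]
          refine le_trans (le_of_eq (Finset.sum_congr rfl fun f hf => ?_)) hUQ
          exact weightedMax_pairEnergy hf x)
      rw [Finset.sum_congr rfl fun f hf => by rw [weightedMax_pairEnergy hf x]] at key
      refine key.trans ?_
      rw [Real.coe_toNNReal _ hu.le]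
      have h1 : (J : ℝ) * (2 * (L.length : ℝ) / J) = 2 * L.length := by field_simp
      have h2 : ((unmarkedArcs S L).card : ℝ) * (4 * (L.length : ℝ) / (ε * lam) / 2 ^ J)
          ≤ L.length * 1 := by
        refine mul_le_mul hU ?_ (by positivity) (by positivity)
        rw [div_le_one (by positivity)]
        exact hJ'
      rw [h1]
      calc Q * ε / (4 * L.length) * (2 * L.length + _ + _)
          ≤ Q * ε / (4 * L.length) * (4 * L.length) :=
            mul_le_mul_of_nonneg_left (by linarith) hu.le
        _ = ε * Q := by field_simp
  · have h1 := h.two_mul_length hL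
    have h2 : ((L.toFinset.filter (fun f => S f = true)).card : ℝ) ≤
        (Fintype.card V : ℝ) ^ 2 * lam := by exact_mod_cast hD.card_marked_le
    simp only
    linarith

end Deterministic

end OneStep

/-! ### One round: probability of failure -/

section OneStepProbability

variable {V : Type} [LinearOrder V]

theorem sampleArcs_isSample {S : Hyperarc V → Bool} {L : List (Hyperarc V)} (hL : L.Nodup)
    {z : Hyperarc V → ℝ≥0} {p : (List (Hyperarc V) × (Hyperarc V → ℝ≥0)) × ℕ}
    (hp : p ∈ (sampleArcs S L z).law.support) : IsSample S L z p.1.1 p.1.2 :=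
  have h := sampleArcs_support hL hp
  ⟨h.1, h.2.1, h.2.2.1⟩

theorem sampleArcs_abs_tail {S : Hyperarc V → Bool} {l : List (Hyperarc V)} (hl : l.Nodup)
    (z : Hyperarc V → ℝ≥0) (g : Hyperarc V → ℝ) {s v : ℝ} (hs : 0 ≤ s) (hv : 0 < v)
    (hg : ∑ f ∈ unmarkedArcs S l, g f ^ 2 ≤ v) :
    (sampleArcs S l z).law.toOuterMeasure
      {p | s < |∑ f ∈ unmarkedArcs S l, g f * keepSign p.1.1 f|} ≤
    ENNReal.ofReal (2 * Real.exp (-(s ^ 2 / (2 * v)))) := by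
  have h1 := sampleArcs_tail hl z g hs hv hg
  have h2 := sampleArcs_tail hl z (fun f => -g f) hs hv (by simpa using hg)
  rw [two_mul, ENNReal.ofReal_add (Real.exp_pos _).le (Real.exp_pos _).le]
  refine le_trans ?_ (add_le_add h1 h2)
  refine le_trans (MeasureTheory.measure_mono fun p hp => ?_) (MeasureTheory.measure_union_le _ _)
  rcases lt_abs.1 (show s < |_| from hp) with h | h
  · exact Or.inl h
  · refine Or.inr ?_
    simpa [neg_mul, Finset.sum_neg_distrib] using h

/-- A layer is at most as large as its thickness `t`, so one factor of each square may be replaced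
by `t`. The smaller variance of thin layers pays for their larger number. -/
theorem sum_sq_weightedLayer_le {ι P : Type} [Fintype P] (a : ι → P → ℝ≥0) {t M : ℝ}
    (ht : 0 ≤ t) (c : P → ℕ) {U : Finset ι} (h : ∑ f ∈ U, weightedLayer a t (2 * t) c f ≤ M) :
    ∑ f ∈ U, weightedLayer a t (2 * t) c f ^ 2 ≤ t * M := by
  refine le_trans ?_ (mul_le_mul_of_nonneg_left h ht)
  rw [Finset.mul_sum]
  refine Finset.sum_le_sum fun f _ => ?_
  have h1 := weightedLayer_nonneg a (show t ≤ 2 * t by linarith) c f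
  have h2 := weightedLayer_le_sub a (show t ≤ 2 * t by linarith) c f
  rw [sq]
  exact mul_le_mul_of_nonneg_right (by linarith) h1

/-- The number of layers is logarithmic. -/
theorem clog_four_mul_le {m : ℕ} (hm : 3 ≤ m) : (Nat.clog 2 (4 * m) : ℝ) ≤ 5 * Real.log m := by
  have hm' : (3 : ℝ) ≤ m := by exact_mod_cast hm
  have h1 : 2 ^ (Nat.clog 2 (4 * m) - 1) < 4 * m := Nat.pow_pred_clog_lt_self (by norm_num) (by omega)
  have h2 : (2 : ℝ) ^ (Nat.clog 2 (4 * m) - 1) ≤ 4 * m := by exact_mod_cast h1.le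
  have h3 := Real.log_le_log (by positivity) h2
  rw [Real.log_pow, Real.log_mul (by norm_num) (by positivity),
    show (4 : ℝ) = 2 ^ 2 by norm_num, Real.log_pow] at h3
  have h4 : 0 < Nat.clog 2 (4 * m) := Nat.clog_pos (by norm_num) (by omega)
  rw [Nat.cast_sub h4] at h3
  push_cast at h3
  have h5 := Real.log_two_gt_d9
  have h6 : 1 ≤ Real.log m := by
    rw [Real.le_log_iff_exp_le (by positivity)]
    exact (Real.exp_one_lt_d9.le.trans (by norm_num)).trans hm'
  nlinarith

/-- Place and value of one non-zero entry leave at most `n² (d + 1) ≤ 5 m² ≤ m⁴` choices. -/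
theorem card_sparseFunctions_le_exp [Fintype V] {m : ℕ} (hm : 3 ≤ m)
    (hV : Fintype.card V ^ 2 ≤ m) {d : ℕ} (hd : d ≤ 4 * m) (r : ℕ) :
    ((sparseFunctions (V × V) d r).card : ℝ) ≤ Real.exp (4 * Real.log m) ^ r := by
  have h1 := card_sparseFunctions_le (P := V × V) d r
  have h2 : Fintype.card (V × V) * (d + 1) ≤ m ^ 4 := by
    rw [Fintype.card_prod, ← sq]
    calc Fintype.card V ^ 2 * (d + 1) ≤ m * (5 * m) := Nat.mul_le_mul hV (by omega)
      _ ≤ m ^ 4 := by nlinarith [Nat.mul_le_mul hm hm]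
  have h3 : Real.exp (4 * Real.log m) = (m : ℝ) ^ 4 := by
    rw [← Real.log_rpow (by positivity), Real.exp_log (by positivity)]
    norm_cast
  rw [h3]
  exact_mod_cast h1.trans (Nat.pow_le_pow_left h2 r)

theorem four_mul_div_le_pow_clog {m lam : ℕ} (hm : 3 ≤ m) {ε : ℝ}
    (h1 : 1 ≤ ε * lam) :
    4 * (m : ℝ) / (ε * lam) ≤ 2 ^ Nat.clog 2 (4 * m) ∧
      ⌊4 * (m : ℝ) / (ε * lam)⌋₊ ≤ 4 * m := by
  have hm' : (3 : ℝ) ≤ m := by exact_mod_cast hm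
  have h2 : 4 * (m : ℝ) / (ε * lam) ≤ 4 * m := div_le_self (by positivity) h1
  constructor
  · refine h2.trans ?_
    exact_mod_cast Nat.le_pow_clog (by norm_num : 1 < 2) (4 * m)
  · exact Nat.floor_le_of_le (by push_cast; exact h2)

/-- Union bound over the levels and the sparse vectors of each level. For the deviation `2m / J` and
variance `Δ M / 2 ^ (k + 1)`, Hoeffding's exponent is `2 ^ (k + 1) ε² lam / (8 J²)`. As `J ≤ 5Λ`,
the constant `1600 = 8 · 8 · 5²` makes it at least `8Λ · 2 ^ (k + 1)`, twice the bound for the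
logarithm of the number of vectors. -/
theorem sampleArcs_not_isGoodStep_le [Fintype V] {S : Hyperarc V → Bool}
    {L : List (Hyperarc V)} (hL : L.Nodup) {z : Hyperarc V → ℝ≥0} {lam : ℕ}
    {D : V × V → Finset (Hyperarc V)} (hD : IsCoreset L z lam S D) {ε : ℝ} (hε : 0 < ε)
    (hε1 : ε ≤ 1) (hm : 3 ≤ L.length) (hV : Fintype.card V ^ 2 ≤ L.length)
    (hlam : 1600 * Real.log L.length ^ 3 / ε ^ 2 ≤ lam)
    (hS : (Fintype.card V : ℝ) ^ 2 * lam ≤ L.length / 8) :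
    (sampleArcs S L z).law.toOuterMeasure {p | ¬ IsGoodStep ε L z p.1} ≤
      ENNReal.ofReal (42 / L.length) := by
  set m : ℕ := L.length with hmdef
  have hm' : (3 : ℝ) ≤ m := by exact_mod_cast hm
  set Λ : ℝ := Real.log m with hΛ
  have hΛ1 : 1 ≤ Λ := by
    rw [hΛ, Real.le_log_iff_exp_le (by positivity)]
    exact (Real.exp_one_lt_d9.le.trans (by norm_num)).trans hm'
  have hεlam2 : 1600 * Λ ^ 3 ≤ ε ^ 2 * lam := by
    rw [div_le_iff₀ (by positivity)] at hlam
    linarith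
  have hεlam : 1 ≤ ε * lam := by
    have h1 : (1 : ℝ) ≤ Λ ^ 3 := one_le_pow₀ hΛ1
    have h2 : ε ^ 2 * lam ≤ ε * lam :=
      mul_le_mul_of_nonneg_right (by nlinarith) (Nat.cast_nonneg _)
    linarith
  have hlam0 : 0 < lam := by
    rcases Nat.eq_zero_or_pos lam with h | h
    · rw [h] at hεlam; norm_num at hεlam
    · exact h
  have hlam0' : (0 : ℝ) < lam := by exact_mod_cast hlam0
  have hne : Nonempty (V × V) := by
    obtain ⟨f, hf⟩ := List.exists_mem_of_length_pos (by omega : 0 < L.length)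
    obtain ⟨p, -⟩ := f.biclique_nonempty
    exact ⟨p⟩
  set J := Nat.clog 2 (4 * m) with hJ
  have hJ0 : 0 < J := Nat.clog_pos (by norm_num) (by omega)
  have hJ0' : (0 : ℝ) < J := by exact_mod_cast hJ0
  have hJΛ : (J : ℝ) ≤ 5 * Λ := clog_four_mul_le hm
  obtain ⟨hJ1, hfloor⟩ := four_mul_div_le_pow_clog hm hεlam
  rw [← hJ] at hJ1
  set Δ : ℝ := 4 * (m : ℝ) / (ε * lam) with hΔ
  set M : ℝ := 4 * (m : ℝ) / ε with hM
  have hΔ0 : 0 < Δ := by positivity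
  have hM0 : 0 < M := by positivity
  set g : ℕ → (V × V → ℕ) → Hyperarc V → ℝ := fun k c f =>
    weightedLayer (relativeWeight S L z) (Δ / 2 ^ (k + 1)) (Δ / 2 ^ k) c f with hg
  -- The filter keeps only vectors whose layers have total mass at most `M`, as the variance bound
  -- requires; those arising from some `x` do.
  set C : ℕ → Finset (V × V → ℕ) := fun k =>
    (sparseFunctions (V × V) ⌊Δ⌋₊ (2 ^ (k + 1))).filter
      (fun c => ∑ f ∈ unmarkedArcs S L, g k c f ≤ M) with hC
  set B : ℕ → (V × V → ℕ) → Set ((List (Hyperarc V) × (Hyperarc V → ℝ≥0)) × ℕ) := fun k c =>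
    {p | 2 * (m : ℝ) / J < |∑ f ∈ unmarkedArcs S L, g k c f * keepSign p.1.1 f|} with hB
  set B₀ : Set ((List (Hyperarc V) × (Hyperarc V → ℝ≥0)) × ℕ) :=
    {p | (m : ℝ) / 4 < ∑ f ∈ unmarkedArcs S L, 1 * keepSign p.1.1 f} with hB₀
  set μ := (sampleArcs S L z).law.toOuterMeasure with hμ
  have hsub : μ {p | ¬ IsGoodStep ε L z p.1} ≤
      μ (B₀ ∪ ⋃ k ∈ Finset.range J, ⋃ c ∈ C k, B k c) := by
    refine PMF.toOuterMeasure_mono _ fun p hp => ?_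
    obtain ⟨hbad, hsupp⟩ := hp
    by_contra hcon
    simp only [Set.mem_union, Set.mem_iUnion, not_or, not_exists] at hcon
    obtain ⟨h0, hk⟩ := hcon
    refine hbad ((sampleArcs_isSample hL hsupp).isGoodStep hL hD hε hlam0 (by omega) hJ0 hJ1 hS
      ?_ ?_)
    · simpa [hB₀] using h0
    · intro k hkJ c hc1 hc2 hc3
      have hcC : c ∈ C k := Finset.mem_filter.2 ⟨mem_sparseFunctions hc1 hc2, hc3⟩
      have := hk k (Finset.mem_range.2 hkJ) c hcC
      simpa [hB] using this
  have htail0 : μ B₀ ≤ ENNReal.ofReal (32 / m) := by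
    have hU : ((unmarkedArcs S L).card : ℝ) ≤ m := by exact_mod_cast card_unmarkedArcs_le hL
    refine (sampleArcs_tail hL z (fun _ => 1) (s := m / 4) (v := m) (by positivity) (by positivity)
      (by simpa using hU)).trans (ENNReal.ofReal_le_ofReal ?_)
    have h1 : ((m : ℝ) / 4) ^ 2 / (2 * m) = m / 32 := by field_simp; norm_num
    rw [h1, Real.exp_neg, inv_le_comm₀ (Real.exp_pos _) (by positivity), inv_div]
    linarith [Real.add_one_le_exp ((m : ℝ) / 32)]
  have htail : ∀ k, ∀ c ∈ C k,
      μ (B k c) ≤ ENNReal.ofReal (2 * Real.exp (-(8 * Λ)) ^ 2 ^ (k + 1)) := by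
    intro k c hc
    have hc2 := (Finset.mem_filter.1 hc).2
    have h2t : Δ / 2 ^ k = 2 * (Δ / 2 ^ (k + 1)) := by
      rw [pow_succ]; field_simp
    simp only [hg] at hc2
    rw [h2t] at hc2
    have hv := sum_sq_weightedLayer_le _ (by positivity) c hc2
    have := sampleArcs_abs_tail hL z (fun f => weightedLayer (relativeWeight S L z)
      (Δ / 2 ^ (k + 1)) (2 * (Δ / 2 ^ (k + 1))) c f) (s := 2 * (m : ℝ) / J)
      (v := Δ / 2 ^ (k + 1) * M) (by positivity) (by positivity) hv
    simp only [hB, hg, h2t]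
    refine this.trans (ENNReal.ofReal_le_ofReal ?_)
    rw [← Real.exp_nat_mul]
    refine mul_le_mul_of_nonneg_left (Real.exp_le_exp.2 ?_) (by norm_num)
    have h3 : (2 * (m : ℝ) / J) ^ 2 / (2 * (Δ / 2 ^ (k + 1) * M)) =
        2 ^ (k + 1) * (ε ^ 2 * lam / (8 * J ^ 2)) := by
      rw [hΔ, hM]; field_simp; norm_num
    rw [h3]
    push_cast
    have h4 : 8 * Λ ≤ ε ^ 2 * lam / (8 * J ^ 2) := by
      rw [le_div_iff₀ (by positivity)]
      calc 8 * Λ * (8 * (J : ℝ) ^ 2) ≤ 8 * Λ * (8 * (5 * Λ) ^ 2) := by gcongr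
        _ = 1600 * Λ ^ 3 := by ring
        _ ≤ _ := hεlam2
    have h5 : (0 : ℝ) < 2 ^ (k + 1) := by positivity
    nlinarith
  have hlevel : ∀ k, μ (⋃ c ∈ C k, B k c) ≤ ENNReal.ofReal (2 / m ^ 3) := by
    intro k
    refine (MeasureTheory.measure_biUnion_finset_le _ _).trans
      ((Finset.sum_le_card_nsmul _ _ _ (htail k)).trans ?_)
    rw [nsmul_eq_mul, ← ENNReal.ofReal_natCast, ← ENNReal.ofReal_mul (Nat.cast_nonneg _)]
    refine ENNReal.ofReal_le_ofReal ?_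
    have h1 : ((C k).card : ℝ) ≤ Real.exp (4 * Λ) ^ 2 ^ (k + 1) :=
      le_trans (by exact_mod_cast Finset.card_filter_le _ _)
        (card_sparseFunctions_le_exp hm hV hfloor _)
    calc ((C k).card : ℝ) * (2 * Real.exp (-(8 * Λ)) ^ 2 ^ (k + 1))
        ≤ Real.exp (4 * Λ) ^ 2 ^ (k + 1) * (2 * Real.exp (-(8 * Λ)) ^ 2 ^ (k + 1)) := by gcongr
      _ = 2 * Real.exp (-(4 * Λ)) ^ 2 ^ (k + 1) := by
          rw [mul_left_comm, ← mul_pow, ← Real.exp_add]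
          congr 3; ring
      -- Bounding by the first power gives an estimate uniform in the level, still small enough to
      -- be summed over `J` levels.
      _ ≤ 2 * Real.exp (-(4 * Λ)) ^ 1 := by
          refine mul_le_mul_of_nonneg_left ?_ (by norm_num)
          refine pow_le_pow_of_le_one (Real.exp_pos _).le ?_ Nat.one_le_two_pow
          rw [Real.exp_le_one_iff]; linarith
      _ ≤ 2 * Real.exp (-(3 * Λ)) := by
          rw [pow_one]
          refine mul_le_mul_of_nonneg_left (Real.exp_le_exp.2 ?_) (by norm_num)
          linarith
      _ = 2 / m ^ 3 := by
          rw [Real.exp_neg, show 3 * Λ = Real.log ((m : ℝ) ^ 3) by rw [Real.log_pow]; norm_num [hΛ],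
            Real.exp_log (by positivity)]
          rfl
  refine hsub.trans ((MeasureTheory.measure_union_le _ _).trans ?_)
  rw [show (42 / m : ℝ) = 32 / m + 10 / m by ring,
    ENNReal.ofReal_add (by positivity) (by positivity)]
  refine add_le_add htail0 ((MeasureTheory.measure_biUnion_finset_le _ _).trans
    ((Finset.sum_le_card_nsmul _ _ _ (fun k _ => hlevel k)).trans ?_))
  rw [nsmul_eq_mul, ← ENNReal.ofReal_natCast, ← ENNReal.ofReal_mul (Nat.cast_nonneg _),
    Finset.card_range]
  refine ENNReal.ofReal_le_ofReal ?_
  have h1 : (J : ℝ) ≤ 5 * m :=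
    hJΛ.trans (by linarith [Real.log_le_sub_one_of_pos (show (0 : ℝ) < m by positivity)])
  calc (J : ℝ) * (2 / (m : ℝ) ^ 3) ≤ 5 * m * (2 / (m : ℝ) ^ 3) := by gcongr
    _ = 10 / (m : ℝ) ^ 2 := by field_simp; norm_num
    _ ≤ 10 / (m : ℝ) := by gcongr; nlinarith

theorem dhOnestep_not_isGoodStep_le [Fintype V] {L : List (Hyperarc V)} (hL : L.Nodup)
    {z : Hyperarc V → ℝ≥0} {lam : ℕ} {ε : ℝ} (hε : 0 < ε)
    (hε1 : ε ≤ 1) (hm : 3 ≤ L.length) (hV : Fintype.card V ^ 2 ≤ L.length)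
    (hlam : 1600 * Real.log L.length ^ 3 / ε ^ 2 ≤ lam)
    (hS : (Fintype.card V : ℝ) ^ 2 * lam ≤ L.length / 8) :
    (dhOnestep L z lam).law.toOuterMeasure {p | ¬ IsGoodStep ε L z p.1} ≤
      ENNReal.ofReal (42 / L.length) := by
  obtain ⟨D, hD⟩ := coresetFinder_spec hL z lam
  rw [dhOnestep, Comp.toOuterMeasure_lift_bind, Comp.toOuterMeasure_lift_bind]
  exact sampleArcs_not_isGoodStep_le hL hD hε hε1 hm hV hlam hS

theorem dhOnestep_support [Fintype V] {L : List (Hyperarc V)} (hL : L.Nodup)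
    {z : Hyperarc V → ℝ≥0} {lam W : ℕ} (hW : ∀ f ∈ L, f.tail.card * f.head.card ≤ W)
    {p : (List (Hyperarc V) × (Hyperarc V → ℝ≥0)) × ℕ}
    (hp : p ∈ (dhOnestep L z lam).law.support) :
    p.1.1.Sublist L ∧ p.2 ≤ 249 * (L.length * W) + 2 * L.length + 5 := by
  obtain ⟨r, hr, rfl⟩ := Comp.support_lift_bind hp
  obtain ⟨s, hs, rfl⟩ := Comp.support_lift_bind hr
  have h1 := sampleArcs_support hL hs
  have h2 := coresetFinder_time_le hL z lam hW
  refine ⟨h1.1, ?_⟩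
  have := h1.2.2.2
  simp only [Timed.tick_time]
  omega

end OneStepProbability

/-! ### The parameters of the rounds and the sum of the errors -/

section Parameters

/-- The left side is of order `log⁷ ρ`. For `m = ρ m*` it bounds the size `n² λ` of the coreset
divided by `m*`, so this choice of `C₂` keeps the coreset below an eighth of the hyperarcs. -/
theorem exists_polylog_le (A : ℝ) : ∃ B₀ : ℝ, ∀ ρ : ℝ, B₀ ≤ ρ →
    16 * A * (2 * Real.log ρ + 5) ^ 3 * Real.logb (4 / 3) ρ ^ 4 + 4 ≤ ρ / 8 := by
  set c : ℝ := 16 * |A| * 27 * 256 + 4 with hc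
  have hc0 : 0 < c := by positivity
  have h1 := (Real.isLittleO_pow_log_id_atTop (n := 7)).def (show 0 < 1 / (8 * c) by positivity)
  have h2 := (h1.and (Filter.eventually_ge_atTop (Real.exp 5)))
  obtain ⟨B₀, hB⟩ := Filter.eventually_atTop.1 h2
  refine ⟨B₀, fun ρ hρ => ?_⟩
  obtain ⟨h3, h4⟩ := hB ρ hρ
  have hρ0 : 0 < ρ := (Real.exp_pos 5).trans_le h4
  set y := Real.log ρ with hy
  have hy5 : 5 ≤ y := by rwa [hy, Real.le_log_iff_exp_le hρ0]
  have h5 : c * y ^ 7 ≤ ρ / 8 := by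
    rw [Real.norm_of_nonneg (by positivity), id, Real.norm_of_nonneg hρ0.le, div_mul_eq_mul_div,
      one_mul, le_div_iff₀ (by positivity)] at h3
    linarith
  have h6 : Real.logb (4 / 3) ρ ≤ 4 * y := by
    rw [Real.logb, ← hy]
    have h7 : (1 : ℝ) / 4 ≤ Real.log (4 / 3) := by
      have := Real.one_sub_inv_le_log_of_pos (show (0 : ℝ) < 4 / 3 by norm_num)
      norm_num at this ⊢
      linarith
    rw [div_le_iff₀ (by linarith)]
    nlinarith
  have h7 : 0 ≤ Real.logb (4 / 3) ρ := by
    refine Real.logb_nonneg (by norm_num) ?_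
    linarith [Real.add_one_le_exp (5 : ℝ)]
  refine le_trans ?_ h5
  calc 16 * A * (2 * y + 5) ^ 3 * Real.logb (4 / 3) ρ ^ 4 + 4
      ≤ 16 * |A| * (3 * y) ^ 3 * (4 * y) ^ 4 + 4 * 1 := by
        gcongr
        · exact le_abs_self A
        · linarith
        · norm_num
    _ ≤ 16 * |A| * (3 * y) ^ 3 * (4 * y) ^ 4 + 4 * y ^ 7 := by
        gcongr
        exact one_le_pow₀ (by linarith)
    _ = c * y ^ 7 := by rw [hc]; ring

variable {n : ℕ} {ε : ℝ}

theorem log_two_le_log_div (hn : 2 ≤ n) (hε : 0 < ε) (hε1 : ε < 1) :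
    0.69 ≤ Real.log (n / ε) := by
  have hn' : (2 : ℝ) ≤ n := by exact_mod_cast hn
  have h1 : (2 : ℝ) ≤ n / ε := by
    rw [le_div_iff₀ hε]; nlinarith
  have := Real.log_le_log (by norm_num) h1
  linarith [Real.log_two_gt_d9]

theorem sq_le_four_mul_targetSize (hn : 2 ≤ n) (hε : 0 < ε) (hε1 : ε < 1) :
    (n : ℝ) ^ 2 ≤ 4 * targetSize n ε ∧ 1 ≤ targetSize n ε := by
  have hn' : (2 : ℝ) ≤ n := by exact_mod_cast hn
  have hy := log_two_le_log_div hn hε hε1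
  have h1 : (0.69 : ℝ) ^ 3 ≤ Real.log (n / ε) ^ 3 := pow_le_pow_left₀ (by norm_num) hy 3
  have h2 : (n : ℝ) ^ 2 ≤ (n : ℝ) ^ 2 / ε ^ 2 := by
    rw [le_div_iff₀ (by positivity)]
    have : ε ^ 2 ≤ 1 := pow_le_one₀ hε.le hε1.le
    nlinarith [sq_nonneg (n : ℝ)]
  have h3 : (n : ℝ) ^ 2 * 0.69 ^ 3 ≤ targetSize n ε :=
    mul_le_mul h2 h1 (by norm_num) (by positivity)
  norm_num at h3
  constructor <;> nlinarith

theorem log_targetSize_le (hn : 2 ≤ n) (hε : 0 < ε) (hε1 : ε < 1) :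
    Real.log (targetSize n ε) ≤ 5 * Real.log (n / ε) := by
  have hn' : (0 : ℝ) < n := by exact_mod_cast (by omega : 0 < n)
  have hy := log_two_le_log_div hn hε hε1
  have hy0 : 0 < Real.log (n / ε) := by linarith
  rw [targetSize, ← div_pow, Real.log_mul (by positivity) (by positivity), Real.log_pow,
    Real.log_pow]
  have := Real.log_le_sub_one_of_pos hy0
  push_cast
  linarith

/-- The parameters of a step satisfy the conditions for its analysis. -/
theorem step_parameters {A B : ℝ} (hA : 1600 ≤ A) (hB : 4 ≤ B)
    (hAB : ∀ ρ : ℝ, B ≤ ρ →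
      16 * A * (2 * Real.log ρ + 5) ^ 3 * Real.logb (4 / 3) ρ ^ 4 + 4 ≤ ρ / 8)
    (hn : 2 ≤ n) (hε : 0 < ε) (hε1 : ε < 1) {m : ℕ} (hm : B * targetSize n ε ≤ m)
    {ℓ δ : ℝ} {lam : ℕ} (hℓ : ℓ = Real.logb (4 / 3) (m / targetSize n ε))
    (hδ : δ = ε / (4 * ℓ ^ 2)) (hlam : lam = ⌈A * Real.log m ^ 3 / δ ^ 2⌉₊) :
    2 ≤ ℓ ∧ 0 < δ ∧ δ ≤ 1 ∧ 3 ≤ m ∧ n ^ 2 ≤ m ∧ 1600 * Real.log m ^ 3 / δ ^ 2 ≤ lam ∧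
      (n : ℝ) ^ 2 * lam ≤ m / 8 := by
  obtain ⟨ht1, ht2⟩ := sq_le_four_mul_targetSize hn hε hε1
  have hn' : (2 : ℝ) ≤ n := by exact_mod_cast hn
  have hy := log_two_le_log_div hn hε hε1
  set y := Real.log (n / ε) with hydef
  set μ := targetSize n ε with hμ
  have hμ0 : 0 < μ := by linarith
  have hm4 : (4 : ℝ) * μ ≤ m := (mul_le_mul_of_nonneg_right hB hμ0.le).trans hm
  have hm0 : (0 : ℝ) < m := by linarith
  have hmsq : n ^ 2 ≤ m := by exact_mod_cast ht1.trans hm4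
  have hm3 : 3 ≤ m := by nlinarith
  set ρ := (m : ℝ) / μ with hρ
  have hρB : B ≤ ρ := by rwa [hρ, le_div_iff₀ hμ0]
  have hρ0 : 0 < ρ := by positivity
  have hℓ2 : 2 ≤ ℓ := by
    rw [hℓ, Real.le_logb_iff_rpow_le (by norm_num) hρ0]
    norm_num
    linarith
  have hδ0 : 0 < δ := by rw [hδ]; positivity
  have hδ1 : δ ≤ 1 := by
    rw [hδ, div_le_one (by positivity)]
    nlinarith
  have hlogm : 0 ≤ Real.log m := Real.log_natCast_nonneg m
  refine ⟨hℓ2, hδ0, hδ1, hm3, hmsq, ?_, ?_⟩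
  · refine le_trans ?_ (hlam ▸ Nat.le_ceil _)
    gcongr
  · have h1 : (lam : ℝ) ≤ A * Real.log m ^ 3 / δ ^ 2 + 1 := by
      rw [hlam]; exact (Nat.ceil_lt_add_one (by positivity)).le
    have hmρ : (m : ℝ) = ρ * μ := by rw [hρ]; field_simp
    have hlogρ : 0 ≤ Real.log ρ := Real.log_nonneg (by linarith)
    -- As `y ≥ 0.69`, `log ρ ≤ 2 y log ρ`, and `log μ ≤ 5 y`. Hence `log³ m` is `y³` times a
    -- function of `ρ` alone, and `y³` is the cube contained in the target size.
    have h2 : Real.log m ≤ (2 * Real.log ρ + 5) * y := by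
      rw [hmρ, Real.log_mul hρ0.ne' hμ0.ne']
      have := log_targetSize_le hn hε hε1
      rw [← hμ, ← hydef] at this
      nlinarith
    have h3 := hAB ρ hρB
    rw [← hℓ] at h3
    have hy0 : 0 < y := by linarith
    calc (n : ℝ) ^ 2 * lam ≤ (n : ℝ) ^ 2 * (A * Real.log m ^ 3 / δ ^ 2 + 1) := by gcongr
      _ = (n : ℝ) ^ 2 * (A * Real.log m ^ 3 / δ ^ 2) + (n : ℝ) ^ 2 := by ring
      _ ≤ (n : ℝ) ^ 2 * (A * ((2 * Real.log ρ + 5) * y) ^ 3 / δ ^ 2) + 4 * μ := by gcongr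
      _ = μ * (16 * A * (2 * Real.log ρ + 5) ^ 3 * ℓ ^ 4 + 4) := by
          have : μ = (n : ℝ) ^ 2 / ε ^ 2 * y ^ 3 := rfl
          rw [this, hδ]
          field_simp
          ring
      _ ≤ μ * (ρ / 8) := by gcongr
      _ = m / 8 := by rw [hmρ]; ring

/-- The total error allowed from a hypergraph with `m` hyperarcs on. -/
def errorBudget (ε B μ : ℝ) (m : ℕ) : ℝ :=
  if B * μ ≤ m then ε / 4 * (1 - 1 / Real.logb (4 / 3) (m / μ)) else 0

theorem two_le_logb_div {B μ : ℝ} (hB : 4 ≤ B) (hμ : 0 < μ) {m : ℝ} (hm : B * μ ≤ m) :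
    2 ≤ Real.logb (4 / 3) (m / μ) := by
  have h : B ≤ m / μ := by rwa [le_div_iff₀ hμ]
  rw [Real.le_logb_iff_rpow_le (by norm_num) (by linarith)]
  norm_num
  linarith

theorem errorBudget_nonneg {B μ : ℝ} (hε : 0 < ε) (hB : 4 ≤ B) (hμ : 0 < μ) (m : ℕ) :
    0 ≤ errorBudget ε B μ m := by
  unfold errorBudget
  split_ifs with h
  · have h1 := two_le_logb_div hB hμ h
    have h2 : 1 / Real.logb (4 / 3) (m / μ) ≤ 1 := by
      rw [div_le_one (by linarith)]; linarith
    exact mul_nonneg (by linarith) (by linarith)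
  · exact le_rfl

theorem errorBudget_le {B μ : ℝ} (hε : 0 < ε) (hB : 4 ≤ B) (hμ : 0 < μ) (m : ℕ) :
    errorBudget ε B μ m ≤ ε / 4 := by
  unfold errorBudget
  split_ifs with h
  · have h1 := two_le_logb_div hB hμ h
    have h2 : 0 ≤ 1 / Real.logb (4 / 3) (m / μ) := by positivity
    nlinarith
  · linarith

/-- Losing a quarter of the hyperarcs lowers the logarithm `ℓ` by at least one, and `1/ℓ² ≤ 1/(ℓ -
1) - 1/ℓ`. Below the threshold the loop stops and no more error arises; there `ℓ ≥ 2` gives `1/ℓ² ≤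
1 - 1/ℓ`. -/
theorem errorBudget_step {B μ : ℝ} (hε : 0 < ε) (hB : 4 ≤ B) (hμ : 0 < μ) {m m' : ℕ}
    (hm : B * μ ≤ m) (hm' : (m' : ℝ) ≤ 3 / 4 * m) :
    ε / (4 * Real.logb (4 / 3) (m / μ) ^ 2) + errorBudget ε B μ m' ≤ errorBudget ε B μ m := by
  have h1 := two_le_logb_div hB hμ hm
  set ℓ := Real.logb (4 / 3) (m / μ) with hℓ
  have hm0 : (0 : ℝ) < m := lt_of_lt_of_le (by nlinarith) hm
  have h2 : ε / (4 * ℓ ^ 2) = ε / 4 * (1 / ℓ ^ 2) := by field_simp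
  rw [h2]
  have h3 : errorBudget ε B μ m = ε / 4 * (1 - 1 / ℓ) := by
    rw [errorBudget, if_pos hm, hℓ]
  rw [h3]
  have hℓ0 : 0 < ℓ := by linarith
  by_cases h : B * μ ≤ m'
  · have h4 := two_le_logb_div hB hμ h
    have h5 : errorBudget ε B μ m' = ε / 4 * (1 - 1 / Real.logb (4 / 3) (m' / μ)) := by
      rw [errorBudget, if_pos h]
    rw [h5]
    set ℓ' := Real.logb (4 / 3) (m' / μ) with hℓ'
    have hm'0 : (0 : ℝ) < m' := lt_of_lt_of_le (by nlinarith) h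
    have h6 : ℓ' ≤ ℓ - 1 := by
      have h7 : Real.logb (4 / 3) (3 / 4 * m / μ) = ℓ - 1 := by
        rw [show 3 / 4 * (m : ℝ) / μ = (m / μ) / (4 / 3) by field_simp, Real.logb_div
          (by positivity) (by norm_num), Real.logb_self_eq_one (by norm_num)]
      rw [← h7]
      refine Real.logb_le_logb_of_le (by norm_num) (by positivity) ?_
      gcongr
    have h8 : 1 / (ℓ - 1) ≤ 1 / ℓ' := one_div_le_one_div_of_le (by linarith) h6
    have h9 : 1 / ℓ + 1 / ℓ ^ 2 ≤ 1 / (ℓ - 1) := by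
      rw [div_add_div _ _ (by positivity) (by positivity), div_le_div_iff₀ (by positivity)
        (by linarith)]
      nlinarith
    rw [← mul_add]
    exact mul_le_mul_of_nonneg_left (by linarith) (by linarith)
  · have h5 : errorBudget ε B μ m' = 0 := by rw [errorBudget, if_neg h]
    rw [h5, add_zero]
    refine mul_le_mul_of_nonneg_left ?_ (by linarith)
    have h9 : 1 / ℓ + 1 / ℓ ^ 2 ≤ 1 := by
      rw [div_add_div _ _ (by positivity) (by positivity), div_le_one (by positivity)]
      nlinarith [pow_pos hℓ0 2]
    linarith

end Parameters

/-! ### The loop: error, size and running time over all rounds -/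

section Loop

theorem length_le_four_pow {V : Type} [Fintype V] {L : List (Hyperarc V)} (hL : L.Nodup) :
    L.length ≤ 4 ^ Fintype.card V := by
  refine hL.length_le_card.trans ((Fintype.card_subtype_le _).trans (le_of_eq ?_))
  rw [Fintype.card_prod, Fintype.card_finset, ← mul_pow]
  norm_num

theorem card_tail_mul_card_head_le {V : Type} {H : DirHypergraph V} {f : Hyperarc V} (hf : f ∈ H.arcs) :
    f.tail.card * f.head.card ≤ H.rank ^ 2 := by
  have h : f.head.card + f.tail.card ≤ H.rank :=
    Finset.le_sup (f := fun f : Hyperarc V => f.head.card + f.tail.card) hf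
  rw [sq]
  exact Nat.mul_le_mul (by omega) (by omega)

theorem Comp.prob_mono {α : Type} {X : Comp α} {E E' : Set (α × ℕ)} (h : E ⊆ E') :
    X.prob E ≤ X.prob E' :=
  ENNReal.toReal_mono (ne_top_of_le_ne_top ENNReal.one_ne_top (PMF.toOuterMeasure_le_one _ _))
    (MeasureTheory.measure_mono h)

variable {V : Type} [LinearOrder V]

/-- The outcome approximates `(L, z)` with lower error `E` and upper error `2 * E`, has at most
`s` hyperarcs, and took at most `t` steps. -/
structure IsGoodRun (L : List (Hyperarc V)) (z : Hyperarc V → ℝ≥0) (E s t : ℝ)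
    (p : (List (Hyperarc V) × (Hyperarc V → ℝ≥0)) × ℕ) : Prop where
  subset : p.1.1 ⊆ L
  lower : ∀ x, (1 - E) * (toHypergraph (L, z)).energy x ≤ (toHypergraph p.1).energy x
  upper : ∀ x, (toHypergraph p.1).energy x ≤ (1 + 2 * E) * (toHypergraph (L, z)).energy x
  length : (p.1.1.length : ℝ) ≤ s
  time : (p.2 : ℝ) ≤ t

theorem isGoodRun_self {L : List (Hyperarc V)} {z : Hyperarc V → ℝ≥0} {E s t : ℝ} {k : ℕ}
    (hE : 0 ≤ E) (hs : (L.length : ℝ) ≤ s) (ht : (k : ℝ) ≤ t) :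
    IsGoodRun L z E s t ((L, z), k) where
  subset := fun _ h => h
  lower := fun x => by nlinarith [(toHypergraph (L, z)).energy_nonneg x]
  upper := fun x => by nlinarith [(toHypergraph (L, z)).energy_nonneg x]
  length := hs
  time := ht

/-- The factor `2` in the upper error absorbs the cross term: `(1 + 2E')(1 + δ) ≤ 1 + 2(δ + E')` for
`E' ≤ 1/2`. In the lower bound the cross term has the favourable sign. -/
theorem IsGoodRun.of_isGoodStep {L : List (Hyperarc V)} {z : Hyperarc V → ℝ≥0}
    {r : List (Hyperarc V) × (Hyperarc V → ℝ≥0)} {δ E E' s t t' : ℝ} {k : ℕ}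
    {p : (List (Hyperarc V) × (Hyperarc V → ℝ≥0)) × ℕ} (hr : r.1 ⊆ L)
    (h : IsGoodStep δ L z r) (h' : IsGoodRun r.1 r.2 E' s t' p) (hδ : 0 ≤ δ) (hE' : 0 ≤ E')
    (hE'2 : E' ≤ 1 / 2) (hE : δ + E' ≤ E) (ht : k + t' ≤ t) :
    IsGoodRun L z E s t (p.1, k + p.2) where
  subset := fun _ hf => hr (h'.subset hf)
  lower := fun x => by
    have h1 := (abs_le.1 (h.energy x)).1
    have h2 := h'.lower x
    have h3 := (toHypergraph (L, z)).energy_nonneg x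
    set Q := (toHypergraph (L, z)).energy x
    have h4 : (1 - E') * ((1 - δ) * Q) ≤ (1 - E') * (toHypergraph r).energy x :=
      mul_le_mul_of_nonneg_left (by linarith) (by linarith)
    refine le_trans ?_ (h4.trans h2)
    have h5 : (1 - E) * Q ≤ (1 - (δ + E')) * Q :=
      mul_le_mul_of_nonneg_right (by linarith) h3
    have h6 : 0 ≤ E' * δ * Q := by positivity
    linarith
  upper := fun x => by
    have h1 := (abs_le.1 (h.energy x)).2
    have h2 := h'.upper x
    have h3 := (toHypergraph (L, z)).energy_nonneg x
    set Q := (toHypergraph (L, z)).energy x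
    have h4 : (1 + 2 * E') * (toHypergraph r).energy x ≤ (1 + 2 * E') * ((1 + δ) * Q) :=
      mul_le_mul_of_nonneg_left (by linarith) (by linarith)
    refine (h2.trans h4).trans ?_
    have h5 : (1 + 2 * (δ + E')) * Q ≤ (1 + 2 * E) * Q :=
      mul_le_mul_of_nonneg_right (by linarith) h3
    have h6 : 0 ≤ (1 - 2 * E') * δ * Q :=
      mul_nonneg (mul_nonneg (by linarith) hδ) h3
    linarith
  length := h'.length
  time := by
    have := h'.time
    push_cast
    linarith

theorem dhLoop_succ (C₁ C₂ ε μ : ℝ) (t : ℕ) (L : List (Hyperarc V)) (z : Hyperarc V → ℝ≥0) :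
    dhLoop C₁ C₂ ε μ (t + 1) L z = (do
      Comp.lift Timed.tick
      let mi ← Comp.lift (lengthT L)
      if C₂ * μ ≤ (mi : ℝ) then
        let r ← dhOnestep L z ⌈C₁ * Real.log (mi : ℝ) ^ 3 /
          (ε / (4 * Real.logb (4 / 3) ((mi : ℝ) / μ) ^ 2)) ^ 2⌉₊
        dhLoop C₁ C₂ ε μ t r.1 r.2
      else return (L, z)) := rfl

/-- Induction on the rounds left, `hlen` saying that enough are left to reach the target size. A
round with `m ≥ n²` hyperarcs fails with probability at most `42/m ≤ 42/n²`. In the running time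
`1036 = 4 · 259`: three quarters pay for the later rounds, and the rest, `259 m W`, for this one,
which takes `249 m W` steps and lower terms. -/
theorem dhLoop_not_isGoodRun_le [Fintype V] {A B ε : ℝ} (hA : 1600 ≤ A) (hB : 4 ≤ B)
    (hAB : ∀ ρ : ℝ, B ≤ ρ →
      16 * A * (2 * Real.log ρ + 5) ^ 3 * Real.logb (4 / 3) ρ ^ 4 + 4 ≤ ρ / 8)
    (hn : 2 ≤ Fintype.card V) (hε : 0 < ε) (hε1 : ε < 1) {W : ℕ} (hW0 : 1 ≤ W) (t : ℕ)
    {L : List (Hyperarc V)} (hL : L.Nodup) (z : Hyperarc V → ℝ≥0)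
    (hW : ∀ f ∈ L, f.tail.card * f.head.card ≤ W)
    (hlen : (L.length : ℝ) ≤ (4 / 3) ^ t * targetSize (Fintype.card V) ε) :
    (dhLoop A B ε (targetSize (Fintype.card V) ε) t L z).law.toOuterMeasure
      {p | ¬ IsGoodRun L z (errorBudget ε B (targetSize (Fintype.card V) ε) L.length)
        (B * targetSize (Fintype.card V) ε) (1036 * (L.length * W) + 2) p} ≤
      t * ENNReal.ofReal (42 / (Fintype.card V : ℝ) ^ 2) := by
  have hμ1 := (sq_le_four_mul_targetSize hn hε hε1).2
  have hn0 : (0 : ℝ) < Fintype.card V := by exact_mod_cast (by omega : 0 < Fintype.card V)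
  have hW0' : (1 : ℝ) ≤ W := by exact_mod_cast hW0
  set μ := targetSize (Fintype.card V) ε with hμ
  have hμ0 : 0 < μ := by linarith
  induction t generalizing L z with
  | zero =>
    rw [dhLoop, Comp.toOuterMeasure_lift_bind, Comp.toOuterMeasure_pure]
    · simp
    · simp only [Set.mem_ofPred_eq, not_not]
      refine isGoodRun_self (errorBudget_nonneg hε hB hμ0 _) ?_ ?_
      · refine hlen.trans ?_
        rw [pow_zero]
        gcongr
        linarith
      · have : (0 : ℝ) ≤ (L.length : ℝ) * W := by positivity
        simp only [Timed.tick_time]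
        push_cast
        linarith
  | succ t ih =>
    have hLW : (L.length : ℝ) ≤ L.length * W := le_mul_of_one_le_right (by positivity) hW0'
    rw [dhLoop_succ, Comp.toOuterMeasure_lift_bind, Comp.toOuterMeasure_lift_bind]
    simp only [lengthT_val, lengthT_time, Timed.tick_time, Set.mem_ofPred_eq]
    by_cases hm : B * μ ≤ (L.length : ℝ)
    · rw [if_pos hm]
      obtain ⟨-, hδ0, hδ1, hm3, hmsq, hlam, hS⟩ := step_parameters hA hB hAB hn hε hε1 hm
        rfl rfl rfl
      rw [← hμ] at hδ0 hδ1 hlam hS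
      have hstep := dhOnestep_not_isGoodStep_le hL (z := z) hδ0 hδ1 hm3 hmsq hlam hS
      set δ := ε / (4 * Real.logb (4 / 3) ((L.length : ℝ) / μ) ^ 2) with hδ
      refine (Comp.toOuterMeasure_bind_le {p | ¬ IsGoodStep δ L z p.1}
        (t * ENNReal.ofReal (42 / (Fintype.card V : ℝ) ^ 2)) ?_).trans ?_
      · intro p hp hpgood
        simp only [Set.mem_ofPred_eq, not_not] at hpgood
        obtain ⟨hsub, htime⟩ := dhOnestep_support hL hW hp
        have hlen' : (p.1.1.length : ℝ) ≤ (4 / 3) ^ t * μ := by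
          refine hpgood.length.trans ?_
          rw [pow_succ] at hlen
          linarith
        refine le_trans (MeasureTheory.measure_mono ?_) (ih (hsub.nodup hL) p.1.2
          (fun f hf => hW f (hsub.subset hf)) hlen')
        intro q hq hgood
        refine hq ?_
        have htime' : (p.2 : ℝ) ≤ 249 * (L.length * W) + 2 * L.length + 5 := by
          exact_mod_cast htime
        have hm3' : (3 : ℝ) ≤ L.length := by exact_mod_cast hm3
        have hpW : (p.1.1.length : ℝ) * W ≤ 3 / 4 * L.length * W :=
          mul_le_mul_of_nonneg_right hpgood.length (by positivity)
        have := hgood.of_isGoodStep (k := 1 + (L.length + 1 + p.2))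
          (E := errorBudget ε B μ L.length) (t := 1036 * (L.length * W) + 2)
          hsub.subset hpgood hδ0.le (errorBudget_nonneg hε hB hμ0 _)
          ((errorBudget_le hε hB hμ0 _).trans (by linarith))
          (errorBudget_step hε hB hμ0 hm hpgood.length) (by push_cast; linarith)
        convert this using 2
        simp only
        omega
      · have h42 : ENNReal.ofReal (42 / (L.length : ℝ)) ≤
            ENNReal.ofReal (42 / (Fintype.card V : ℝ) ^ 2) := by
          refine ENNReal.ofReal_le_ofReal ?_
          gcongr
          exact_mod_cast hmsq
        push_cast
        rw [add_mul, one_mul, add_comm]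
        exact add_le_add le_rfl (hstep.trans h42)
    · rw [if_neg hm, Comp.toOuterMeasure_pure]
      · simp
      · simp only [Set.mem_ofPred_eq, not_not]
        refine isGoodRun_self (errorBudget_nonneg hε hB hμ0 _) (not_le.1 hm).le ?_
        push_cast
        linarith

/-- There are at most `4^n` hyperarcs and `4 ≤ (4/3)^5`, so at most `5n` rounds, each failing with
probability at most `42/n²`. -/
theorem dhSparsify_not_isGoodRun_le [Fintype V] {A B ε : ℝ} (hA : 1600 ≤ A) (hB : 4 ≤ B)
    (hAB : ∀ ρ : ℝ, B ≤ ρ →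
      16 * A * (2 * Real.log ρ + 5) ^ 3 * Real.logb (4 / 3) ρ ^ 4 + 4 ≤ ρ / 8)
    (hn : 2 ≤ Fintype.card V) (hε : 0 < ε) (hε1 : ε < 1) {W : ℕ} (hW0 : 1 ≤ W)
    {L : List (Hyperarc V)} (hL : L.Nodup) (z : Hyperarc V → ℝ≥0)
    (hW : ∀ f ∈ L, f.tail.card * f.head.card ≤ W) :
    (dhSparsify A B (Fintype.card V) ε L z).law.toOuterMeasure
      {p | ¬ IsGoodRun L z (ε / 4) (B * targetSize (Fintype.card V) ε)
        (1037 * (L.length * W) + 4) p} ≤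
      ENNReal.ofReal (210 / (Fintype.card V : ℝ)) := by
  have hμ1 := (sq_le_four_mul_targetSize hn hε hε1).2
  have hn0 : (0 : ℝ) < Fintype.card V := by exact_mod_cast (by omega : 0 < Fintype.card V)
  have hW0' : (1 : ℝ) ≤ W := by exact_mod_cast hW0
  have hLW : (L.length : ℝ) ≤ L.length * W := le_mul_of_one_le_right (by positivity) hW0'
  rw [dhSparsify, Comp.toOuterMeasure_lift_bind, Comp.toOuterMeasure_lift_bind]
  simp only [lengthT_val, lengthT_time, Timed.tick_time, Set.mem_ofPred_eq]
  set μ := targetSize (Fintype.card V) ε with hμ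
  have hμ0 : 0 < μ := by linarith
  set T := ⌈Real.logb (4 / 3) ((L.length : ℝ) / μ)⌉₊ with hT
  have hlen : (L.length : ℝ) ≤ (4 / 3) ^ T * μ := by
    rcases Nat.eq_zero_or_pos L.length with h0 | h0
    · rw [h0]; push_cast; positivity
    · have h0' : (0 : ℝ) < L.length := by exact_mod_cast h0
      have h1 := Nat.le_ceil (Real.logb (4 / 3) ((L.length : ℝ) / μ))
      rw [← hT, Real.logb_le_iff_le_rpow (by norm_num) (by positivity), Real.rpow_natCast,
        div_le_iff₀ hμ0] at h1
      exact h1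
  have hT5 : T ≤ 5 * Fintype.card V := by
    rw [hT, Nat.ceil_le]
    rcases Nat.eq_zero_or_pos L.length with h0 | h0
    · rw [h0]; simp
    · have h0' : (0 : ℝ) < L.length := by exact_mod_cast h0
      rw [Real.logb_le_iff_le_rpow (by norm_num) (by positivity), Real.rpow_natCast, pow_mul]
      have h1 : (L.length : ℝ) ≤ 4 ^ Fintype.card V := by exact_mod_cast length_le_four_pow hL
      refine (div_le_self h0'.le hμ1).trans (h1.trans ?_)
      gcongr
      norm_num
  refine le_trans (MeasureTheory.measure_mono ?_)
    ((dhLoop_not_isGoodRun_le hA hB hAB hn hε hε1 hW0 T hL z hW hlen).trans ?_)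
  · intro q hq hgood
    refine hq ⟨hgood.subset, fun x => le_trans ?_ (hgood.lower x),
      fun x => (hgood.upper x).trans ?_, hgood.length, ?_⟩
    · have := errorBudget_le hε hB hμ0 L.length
      exact mul_le_mul_of_nonneg_right (by linarith) ((toHypergraph (L, z)).energy_nonneg x)
    · have := errorBudget_le hε hB hμ0 L.length
      exact mul_le_mul_of_nonneg_right (by linarith) ((toHypergraph (L, z)).energy_nonneg x)
    · have := hgood.time
      push_cast
      linarith
  · rw [← ENNReal.ofReal_natCast, ← ENNReal.ofReal_mul (Nat.cast_nonneg _)]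
    refine ENNReal.ofReal_le_ofReal ?_
    have h1 : (T : ℝ) ≤ 5 * Fintype.card V := by exact_mod_cast hT5
    calc (T : ℝ) * (42 / (Fintype.card V : ℝ) ^ 2)
        ≤ 5 * Fintype.card V * (42 / (Fintype.card V : ℝ) ^ 2) := by gcongr
      _ = 210 / (Fintype.card V : ℝ) := by field_simp; norm_num

theorem dhSparsify_nil (A B ε : ℝ) (z : Hyperarc V → ℝ≥0)
    {E : Set ((List (Hyperarc V) × (Hyperarc V → ℝ≥0)) × ℕ)} (n : ℕ)
    (h : ∀ k, (([], z), k) ∈ E) :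
    1 ≤ (dhSparsify A B n ε ([] : List (Hyperarc V)) z).prob E := by
  have := Comp.one_sub_le_prob (X := dhSparsify A B n ε ([] : List (Hyperarc V)) z) (E := E)
    le_rfl (by
      rw [dhSparsify, Comp.toOuterMeasure_lift_bind, Comp.toOuterMeasure_lift_bind]
      simp only [lengthT_val, List.length_nil, Nat.cast_zero, zero_div, Real.logb_zero,
        Nat.ceil_zero]
      rw [dhLoop, Comp.toOuterMeasure_lift_bind, Comp.toOuterMeasure_pure]
      · simp
      · simp [h])
  simpa using this

end Loop

/-! ### The constants and the theorem -/

/-- `A` and `B` are the constants of the algorithm, each sufficiently large, and `K` is the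
constant hidden in the `O`-notation.  `L` lists the hyperarcs of `H` in an arbitrary order. -/
theorem theorem1 :
    ∃ A₀ : ℝ, 0 < A₀ ∧ ∀ A : ℝ, A₀ ≤ A →
    ∃ B₀ : ℝ, 0 < B₀ ∧ ∀ B : ℝ, B₀ ≤ B →
    ∃ K : ℝ, 0 < K ∧
      ∀ (V : Type) [Fintype V] [LinearOrder V] (H : DirHypergraph V)
        (L : List (Hyperarc V)), L.Nodup → L.toFinset = H.arcs →
      ∀ ε : ℝ, 0 < ε → ε < 1 →
        1 - K / (Fintype.card V : ℝ) ≤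
          (dhSparsify A B (Fintype.card V) ε L H.weight).prob
            {p | H.IsSpectralSparsifier ε (toHypergraph p.1) ∧
              ((toHypergraph p.1).arcs.card : ℝ) ≤
                K * ((Fintype.card V : ℝ) ^ 2 / ε ^ 2 *
                  Real.log ((Fintype.card V : ℝ) / ε) ^ 3)} ∧
        (H.arcs.Nonempty →
          1 - K / (Fintype.card V : ℝ) ≤
            (dhSparsify A B (Fintype.card V) ε L H.weight).prob
              {p | (p.2 : ℝ) ≤ K * ((H.arcs.card : ℝ) * (H.rank : ℝ) ^ 2)}) := by
  refine ⟨1600, by norm_num, fun A hA => ?_⟩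
  obtain ⟨B₁, hB₁⟩ := exists_polylog_le A
  -- `B₁` keeps the coresets small; `4` gives `ℓ ≥ 2` and `n² ≤ m` in every round.
  refine ⟨max B₁ 4, by positivity, fun B hB => ?_⟩
  have hB4 : 4 ≤ B := (le_max_right _ _).trans hB
  have hAB : ∀ ρ : ℝ, B ≤ ρ →
      16 * A * (2 * Real.log ρ + 5) ^ 3 * Real.logb (4 / 3) ρ ^ 4 + 4 ≤ ρ / 8 :=
    fun ρ hρ => hB₁ ρ (((le_max_left _ _).trans hB).trans hρ)
  -- `B` serves the size of the output, `1041 = 1037 + 4` the running time; the sum also exceeds the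
  -- `210` of the failure probability.
  refine ⟨B + 1041, by linarith, fun V _ _ H L hL hLH ε hε hε1 => ?_⟩
  have hH : toHypergraph (L, H.weight) = H := by
    rw [toHypergraph, hLH]
  have hcard : H.arcs.card = L.length := by
    rw [← hLH, List.toFinset_card_of_nodup hL]
  have hnonneg : ∀ E, 0 ≤ (dhSparsify A B (Fintype.card V) ε L H.weight).prob E :=
    fun E => ENNReal.toReal_nonneg
  rcases Nat.lt_or_ge (Fintype.card V) 2 with hn | hn
  · interval_cases hV : Fintype.card V
    · have hempty : IsEmpty V := Fintype.card_eq_zero_iff.1 hV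
      obtain rfl : L = [] := by
        refine List.eq_nil_iff_forall_not_mem.2 fun f _ => ?_
        obtain ⟨p, -⟩ := f.biclique_nonempty
        exact hempty.elim p.1
      have harcs : H.arcs = ∅ := by rw [← hLH]; rfl
      refine ⟨?_, fun h => absurd harcs h.ne_empty⟩
      -- For `n = 0` the quotient `K / n` is `0` by convention, so certainty is claimed; it holds
      -- because there are no hyperarcs.
      rw [Nat.cast_zero, div_zero, sub_zero]
      refine dhSparsify_nil A B ε H.weight _ fun k => ?_
      refine ⟨?_, by simp [toHypergraph]⟩
      rw [hH]
      refine ⟨fun f hf => hf, fun x => ?_⟩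
      simp [DirHypergraph.energy, harcs]
    -- With one vertex the claimed lower bound for the probability is not positive.
    · have h : 1 - (B + 1041) / ((1 : ℕ) : ℝ) ≤ 0 := by push_cast; linarith
      exact ⟨h.trans (hnonneg _), fun _ => h.trans (hnonneg _)⟩
  · have hn0 : (0 : ℝ) < Fintype.card V := by exact_mod_cast (by omega : 0 < Fintype.card V)
    have hprob : ∀ W : ℕ, 1 ≤ W → (∀ f ∈ L, f.tail.card * f.head.card ≤ W) →
        1 - (B + 1041) / (Fintype.card V : ℝ) ≤
          (dhSparsify A B (Fintype.card V) ε L H.weight).prob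
            {p | IsGoodRun L H.weight (ε / 4) (B * targetSize (Fintype.card V) ε)
              (1037 * (L.length * W) + 4) p} := by
      intro W hW0 hW
      refine le_trans ?_ (Comp.one_sub_le_prob (by positivity)
        (dhSparsify_not_isGoodRun_le hA hB4 hAB hn hε hε1 hW0 hL H.weight hW))
      gcongr
      linarith
    constructor
    -- The maximum with `1` covers a hypergraph without hyperarcs, whose rank is `0`.
    · refine (hprob (max 1 (H.rank ^ 2)) (le_max_left _ _) fun f hf =>
        (card_tail_mul_card_head_le (hLH ▸ List.mem_toFinset.2 hf)).trans
          (le_max_right _ _)).trans (Comp.prob_mono fun p hp => ?_)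
      have hp : IsGoodRun L H.weight _ _ _ p := hp
      have hμ1 := (sq_le_four_mul_targetSize hn hε hε1).2
      refine ⟨⟨?_, fun x => ?_⟩, ?_⟩
      · rw [← hLH]
        intro f hf
        exact List.mem_toFinset.2 (hp.subset (List.mem_toFinset.1 hf))
      · have h1 := hp.lower x
        have h2 := hp.upper x
        have h3 := H.energy_nonneg x
        rw [hH] at h1 h2
        constructor
        · refine le_trans (mul_le_mul_of_nonneg_right ?_ h3) h1
          linarith
        · refine h2.trans (mul_le_mul_of_nonneg_right ?_ h3)
          linarith
      · have h1 : ((toHypergraph p.1).arcs.card : ℝ) ≤ p.1.1.length := by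
          exact_mod_cast List.toFinset_card_le p.1.1
        refine (h1.trans hp.length).trans ?_
        exact mul_le_mul_of_nonneg_right (by linarith) (by linarith)
    · rintro ⟨f, hf⟩
      have hfr : f.tail.card * f.head.card ≤ H.rank ^ 2 := card_tail_mul_card_head_le hf
      have hr : 1 ≤ H.rank ^ 2 :=
        (Nat.mul_pos f.2.1.card_pos f.2.2.card_pos).trans_le hfr
      refine (hprob (H.rank ^ 2) hr fun f hf =>
        card_tail_mul_card_head_le (hLH ▸ List.mem_toFinset.2 hf)).trans
          (Comp.prob_mono fun p hp => ?_)
      have hp : IsGoodRun L H.weight _ _ _ p := hp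
      have hm : 1 ≤ L.length := by
        rw [← hcard]; exact Finset.card_pos.2 ⟨f, hf⟩
      have h1 : (1 : ℝ) ≤ (L.length : ℝ) * (H.rank : ℝ) ^ 2 := by
        exact_mod_cast Nat.mul_pos hm hr
      have h2 := hp.time
      push_cast at h2
      rw [Set.mem_ofPred_eq, hcard]
      nlinarith

end
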